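/- Let $\mathbb K$ be a field of characteristic zero, let $P$ be a unital Noetherian commutative Poisson algebra over $\mathbb K$, and let $J\subset P$ be a coisotropic ideal, i.e. $\{J,J\}\subset J$. Let $(P/J)^J=\{p+J : p\in P,\ \{p,J\}\subset J\}\subset P/J$, a Poisson algebra with $\{p+J,q+J\}=\{p,q\}+J$. Let $\mathcal M$ be a negatively graded vector space with finite-dimensional homogeneous components, with homogeneous basis $(e_i)$, and let $\mathcal M^*$ be its degreewise dual, with dual basis $(e_i^*)$, $\deg e_i^*=-\deg e_i$. On the graded commutative algebra $X_0=P\otimes \mathrm{Sym}(\mathcal M\oplus\mathcal M^*)$ consider the graded Poisson bracket of degree $0$ that extends the bracket of $P$, for which elements of $P$ commute with $\mathcal M\oplus\mathcal M^*$, and with $\{e_i,e_j\}=\{e_i^*,e_j^*\}=0$, $\{e_i,e_j^*\}=\delta_{ij}$ and $\{e_j^*,e_i\}=-(-1)^{\deg e_i\deg e_j^*}\delta_{ij}$. Let $\mathcal F^pX_0$ be the ideal generated by the elements of degree at least $p$, let $X=\bigoplus_j X^j$ with $X^j=\varprojlim_p X_0^j/(\mathcal F^pX_0\cap X_0^j)$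 be the completion, with the extended product and bracket, and let $I\subset X$ be the ideal with components $I^j=\varprojlim_p (\mathcal F^1X_0\cap X_0^j)/(\mathcal F^{p+1}X_0\cap X_0^j)$. Let $R\in X^1$ be such that $(X,R)$ is a BFV model for $P$ and $J$. This means that $\{R,R\}=0$ and that, for the differential $d_R=\{R,-\}$ and the differential it induces on $X/I$, one has $H^j(X/I,d_R)=0$ for $j\ne 0$ and $H^0(X/I,d_R)=P/J$, in the sense that the natural map $P\to H^0(X/I,d_R)$ is surjective with kernel $J$. Then the product and the bracket of $X$ induce the structure of a Poisson algebra on $H^0(X,d_R)$. Let $\pi:X^0\to P$ denote the projection onto the $P$-component, i.e. onto the terms without factors from $\mathcal M\oplus\mathcal M^*$. Then $$\Phi: H^0(X,d_R)\longrightarrow (P/J)^J,\qquad \Phi([x])=\pi(x)+J,$$ is a well-defined isomorphism of unital Poisson algebras. -/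

import Mathlib

noncomputable section

open scoped BigOperators

/-! # Poisson algebras, coisotropic ideals and reduction -/

/-- A (commutative, unital) Poisson algebra over `𝕜`. -/
class PoissonAlgebra (𝕜 : Type*) (A : Type*) [Field 𝕜] [CommRing A] [Algebra 𝕜 A] where
  bracket : A →ₗ[𝕜] A →ₗ[𝕜] A
  bracket_self : ∀ a, bracket a a = 0
  jacobi : ∀ a b c, bracket a (bracket b c) = bracket (bracket a b) c + bracket b (bracket a c)
  leibniz : ∀ a b c, bracket a (b * c) = bracket a b * c + b * bracket a c

/-- The Poisson bracket `{a, b}` of a Poisson algebra over `𝕜`. -/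
def pbr (𝕜 : Type*) {A : Type*} [Field 𝕜] [CommRing A] [Algebra 𝕜 A] [PoissonAlgebra 𝕜 A]
    (a b : A) : A :=
  PoissonAlgebra.bracket (𝕜 := 𝕜) a b

/-- An ideal `J` is coisotropic if `{J, J} ⊆ J`. -/
class IsCoisotropic (𝕜 : Type*) {A : Type*} [Field 𝕜] [CommRing A] [Algebra 𝕜 A]
    [PoissonAlgebra 𝕜 A] (J : Ideal A) : Prop where
  bracket_mem : ∀ a ∈ J, ∀ b ∈ J, pbr 𝕜 a b ∈ J

namespace Reduction

variable (𝕜 : Type*) {A : Type*} [Field 𝕜] [CommRing A] [Algebra 𝕜 A] [PoissonAlgebra 𝕜 A]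

theorem pbr_add_right (a b c : A) : pbr 𝕜 a (b + c) = pbr 𝕜 a b + pbr 𝕜 a c := by
  simp [pbr]

theorem pbr_add_left (a b c : A) : pbr 𝕜 (a + b) c = pbr 𝕜 a c + pbr 𝕜 b c := by
  simp [pbr]

theorem pbr_sub_left (a b c : A) : pbr 𝕜 (a - b) c = pbr 𝕜 a c - pbr 𝕜 b c := by
  simp [pbr]

theorem pbr_sub_right (a b c : A) : pbr 𝕜 a (b - c) = pbr 𝕜 a b - pbr 𝕜 a c := by
  simp [pbr]

theorem pbr_zero_right (a : A) : pbr 𝕜 a 0 = 0 := by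
  simp [pbr]

theorem pbr_zero_left (a : A) : pbr 𝕜 0 a = 0 := by
  simp [pbr]

theorem pbr_smul_right (k : 𝕜) (a b : A) : pbr 𝕜 a (k • b) = k • pbr 𝕜 a b := by
  simp [pbr]

theorem pbr_smul_left (k : 𝕜) (a b : A) : pbr 𝕜 (k • a) b = k • pbr 𝕜 a b := by
  simp [pbr]

theorem pbr_self (a : A) : pbr 𝕜 a a = 0 := PoissonAlgebra.bracket_self a

theorem pbr_skew (a b : A) : pbr 𝕜 a b = -pbr 𝕜 b a := by
  have h := pbr_self 𝕜 (a + b)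
  rw [pbr_add_left, pbr_add_right, pbr_add_right, pbr_self, pbr_self, zero_add, add_zero] at h
  exact eq_neg_of_add_eq_zero_left h

theorem pbr_jacobi (a b c : A) :
    pbr 𝕜 a (pbr 𝕜 b c) = pbr 𝕜 (pbr 𝕜 a b) c + pbr 𝕜 b (pbr 𝕜 a c) :=
  PoissonAlgebra.jacobi a b c

theorem pbr_leibniz (a b c : A) : pbr 𝕜 a (b * c) = pbr 𝕜 a b * c + b * pbr 𝕜 a c :=
  PoissonAlgebra.leibniz a b c

theorem pbr_leibniz_left (a b c : A) : pbr 𝕜 (a * b) c = a * pbr 𝕜 b c + b * pbr 𝕜 a c := by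
  rw [pbr_skew, pbr_leibniz, pbr_skew 𝕜 c a, pbr_skew 𝕜 c b]
  ring

theorem pbr_one_left (a : A) : pbr 𝕜 1 a = 0 := by
  have h := pbr_leibniz_left 𝕜 1 1 a
  simpa using h

theorem pbr_algebraMap_left (k : 𝕜) (a : A) : pbr 𝕜 (algebraMap 𝕜 A k) a = 0 := by
  rw [Algebra.algebraMap_eq_smul_one, pbr_smul_left, pbr_one_left, smul_zero]

/-- The subalgebra of all `p` with `{p, J} ⊆ J`. -/
def normalizer (J : Ideal A) : Subalgebra 𝕜 A where
  carrier := {p | ∀ b ∈ J, pbr 𝕜 p b ∈ J}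
  mul_mem' := by
    intro p q hp hq b hb
    rw [pbr_leibniz_left]
    exact J.add_mem (J.mul_mem_left _ (hq b hb)) (J.mul_mem_left _ (hp b hb))
  add_mem' := by
    intro p q hp hq b hb
    rw [pbr_add_left]
    exact J.add_mem (hp b hb) (hq b hb)
  algebraMap_mem' := by
    intro k b _
    rw [pbr_algebraMap_left]
    exact J.zero_mem

/-- `(P/J)^J`: the subalgebra of `P/J` of all `p + J` with `{p, J} ⊆ J`. -/
def invariants (J : Ideal A) : Subalgebra 𝕜 (A ⧸ J) :=
  (normalizer 𝕜 J).map (Ideal.Quotient.mkₐ 𝕜 J)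

variable {𝕜}

/-- A representative in `P` of an element of `(P/J)^J`. -/
def rep {J : Ideal A} (u : invariants 𝕜 J) : A := u.2.choose

theorem rep_mem {J : Ideal A} (u : invariants 𝕜 J) : rep u ∈ normalizer 𝕜 J :=
  u.2.choose_spec.1

theorem mk_rep {J : Ideal A} (u : invariants 𝕜 J) : Ideal.Quotient.mk J (rep u) = u :=
  u.2.choose_spec.2

variable (J : Ideal A)

theorem pbr_mem_normalizer {p q : A} (hp : p ∈ normalizer 𝕜 J) (hq : q ∈ normalizer 𝕜 J) :
    pbr 𝕜 p q ∈ normalizer 𝕜 J := by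
  intro b hb
  have h := pbr_jacobi 𝕜 p q b
  rw [← sub_eq_iff_eq_add] at h
  rw [← h]
  exact J.sub_mem (hp _ (hq b hb)) (hq _ (hp b hb))

theorem mk_pbr_congr {p p' q q' : A} (hq : q ∈ normalizer 𝕜 J) (hp' : p' ∈ normalizer 𝕜 J)
    (h1 : Ideal.Quotient.mk J p = Ideal.Quotient.mk J p')
    (h2 : Ideal.Quotient.mk J q = Ideal.Quotient.mk J q') :
    Ideal.Quotient.mk J (pbr 𝕜 p q) = Ideal.Quotient.mk J (pbr 𝕜 p' q') := by
  rw [Ideal.Quotient.eq] at *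
  have h3 : pbr 𝕜 p q - pbr 𝕜 p' q' = -pbr 𝕜 q (p - p') + pbr 𝕜 p' (q - q') := by
    rw [← pbr_skew, pbr_sub_left, pbr_sub_right]; ring
  rw [h3]
  exact J.add_mem (J.neg_mem (hq _ h1)) (hp' _ h2)

/-- The bracket `{p + J, q + J} = {p, q} + J` on `(P/J)^J`, computed on representatives;
the next lemma shows that it does not depend on them. -/
def invBracket (u v : invariants 𝕜 J) : invariants 𝕜 J :=
  ⟨Ideal.Quotient.mk J (pbr 𝕜 (rep u) (rep v)),
    ⟨pbr 𝕜 (rep u) (rep v), pbr_mem_normalizer J (rep_mem u) (rep_mem v), rfl⟩⟩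

theorem invBracket_eq {u v : invariants 𝕜 J} {p q : A} (hp : p ∈ normalizer 𝕜 J)
    (hu : Ideal.Quotient.mk J p = u) (hv : Ideal.Quotient.mk J q = v) :
    (invBracket J u v : A ⧸ J) = Ideal.Quotient.mk J (pbr 𝕜 p q) :=
  mk_pbr_congr J (rep_mem v) hp ((mk_rep u).trans hu.symm) ((mk_rep v).trans hv.symm)

/-- The Poisson algebra `(P/J)^J`. -/
instance invariantsPoisson : PoissonAlgebra 𝕜 (invariants 𝕜 J) where
  bracket := LinearMap.mk₂ 𝕜 (invBracket J)
    (by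
      intro u v w
      apply Subtype.ext
      rw [invBracket_eq J ((normalizer 𝕜 J).add_mem (rep_mem u) (rep_mem v))
        (by rw [map_add, mk_rep, mk_rep]; rfl) (mk_rep w), pbr_add_left, map_add]
      rfl)
    (by
      intro k u v
      apply Subtype.ext
      rw [invBracket_eq J ((normalizer 𝕜 J).smul_mem (rep_mem u) k)
        (by rw [← Ideal.Quotient.mkₐ_eq_mk 𝕜, map_smul, Ideal.Quotient.mkₐ_eq_mk, mk_rep]; rfl)
        (mk_rep v), pbr_smul_left, ← Ideal.Quotient.mkₐ_eq_mk 𝕜, map_smul]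
      rfl)
    (by
      intro u v w
      apply Subtype.ext
      rw [invBracket_eq J (rep_mem u) (mk_rep u) (q := rep v + rep w)
        (by rw [map_add, mk_rep, mk_rep]; rfl), pbr_add_right, map_add]
      rfl)
    (by
      intro k u v
      apply Subtype.ext
      rw [invBracket_eq J (rep_mem u) (mk_rep u) (q := k • rep v)
        (by rw [← Ideal.Quotient.mkₐ_eq_mk 𝕜, map_smul, Ideal.Quotient.mkₐ_eq_mk, mk_rep]; rfl),
        pbr_smul_right, ← Ideal.Quotient.mkₐ_eq_mk 𝕜, map_smul]
      rfl)
  bracket_self := by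
    intro u
    apply Subtype.ext
    change Ideal.Quotient.mk J (pbr 𝕜 (rep u) (rep u)) = 0
    rw [pbr_self, map_zero]
  jacobi := by
    intro a b c
    apply Subtype.ext
    have key : ∀ u v w : invariants 𝕜 J, (invBracket J u (invBracket J v w) : A ⧸ J) =
        Ideal.Quotient.mk J (pbr 𝕜 (rep u) (pbr 𝕜 (rep v) (rep w))) := fun u v w =>
      invBracket_eq J (rep_mem u) (mk_rep u) rfl
    have key' : (invBracket J (invBracket J a b) c : A ⧸ J) =
        Ideal.Quotient.mk J (pbr 𝕜 (pbr 𝕜 (rep a) (rep b)) (rep c)) :=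
      invBracket_eq J (pbr_mem_normalizer J (rep_mem a) (rep_mem b)) rfl (mk_rep c)
    change (invBracket J a (invBracket J b c) : A ⧸ J) =
      (invBracket J (invBracket J a b) c : A ⧸ J) + (invBracket J b (invBracket J a c) : A ⧸ J)
    rw [key, key, key', pbr_jacobi, map_add]
  leibniz := by
    intro a b c
    apply Subtype.ext
    change (invBracket J a (b * c) : A ⧸ J) =
      (invBracket J a b : A ⧸ J) * (c : A ⧸ J) + (b : A ⧸ J) * (invBracket J a c : A ⧸ J)
    rw [invBracket_eq J (rep_mem a) (mk_rep a) (q := rep b * rep c)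
      (by rw [map_mul, mk_rep, mk_rep]; rfl), pbr_leibniz, map_add, map_mul, map_mul,
      mk_rep, mk_rep]
    rfl

end Reduction

/-! # The graded Poisson algebra `X` -/

/-- A negatively graded vector space `ℳ` with finite-dimensional homogeneous components, given by
a homogeneous basis `(e i)`, where `e i` has degree `-(deg i) < 0`. Each degree contains finitely
many basis vectors. The linear order only serves to write monomials in a normal form. -/
structure GhostBasis where
  ι : Type*
  [order : LinearOrder ι]
  deg : ι → ℕ
  deg_pos : ∀ i, 0 < deg i
  finite_deg : ∀ k, {i | deg i = k}.Finite

namespace BFV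

attribute [instance] GhostBasis.order

/-- The basis of `ℳ ⊕ ℳ*` consisting of the `e i` and of the dual vectors `e* i`. -/
abbrev Gen (M : GhostBasis) : Type _ := M.ι ⊕ₗ M.ι

variable {M : GhostBasis}

/-- The generator `e i`, of degree `-(deg i)`. -/
def ee (i : M.ι) : Gen M := Sum.inlₗ i

/-- The dual generator `e* i`, of degree `deg i`. -/
def es (i : M.ι) : Gen M := Sum.inrₗ i

/-- The absolute value of the degree of a generator. -/
def absDeg (g : Gen M) : ℕ := Sum.elim M.deg M.deg (ofLex g)

/-- The degree of a generator. -/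
def genDeg (g : Gen M) : ℤ := Sum.elim (fun i => -(M.deg i : ℤ)) (fun i => (M.deg i : ℤ)) (ofLex g)

/-- The degree of a generator if it is positive, and `0` otherwise. -/
def genGhost (g : Gen M) : ℕ := Sum.elim (fun _ => 0) M.deg (ofLex g)

variable (M) in
/-- Exponents of monomials in the generators. The monomial `z ^ m` is the product of the `g ^ m g`
in increasing order of `g`. -/
abbrev Expo : Type _ := Gen M →₀ ℕ

/-- The total degree of a monomial. -/
def degree (m : Expo M) : ℤ := m.sum fun g k => k * genDeg g

/-- The total degree of the factors of positive degree of a monomial. -/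
def ghost (m : Expo M) : ℕ := m.sum fun g k => k * genGhost g

/-- The monomials that are nonzero in the graded symmetric algebra: the square of an odd generator
vanishes. The monomials `z ^ m` with `Allowed m` form a basis of `Sym(ℳ ⊕ ℳ*)`. -/
def Allowed (m : Expo M) : Prop := ∀ g, Odd (absDeg g) → m g ≤ 1

instance (m : Expo M) : Decidable (Allowed m) := Classical.dec _

/-- The Koszul sign in `z ^ a * z ^ b = sgn a b • z ^ (a + b)`: the factors of `z ^ b` are moved to
the left past the larger factors of `z ^ a`. -/
def sgn (a b : Expo M) : ℤ :=
  (-1) ^ (a.sum fun g k => b.sum fun h l => if h < g then k * l * (absDeg g * absDeg h) else 0)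

variable (M) in
/-- Formal `P`-linear combinations `x = ∑ m, x m • z ^ m` of monomials (possibly infinite). The
homogeneous components `X^j` of the graded algebra `X` are submodules, see `comp`. -/
def Series (P : Type*) : Type _ := Expo M → P

section Series

variable {P : Type*} [CommRing P]

instance : AddCommGroup (Series M P) := inferInstanceAs (AddCommGroup (Expo M → P))

instance {𝕜 : Type*} [Field 𝕜] [Algebra 𝕜 P] : Module 𝕜 (Series M P) :=
  inferInstanceAs (Module 𝕜 (Expo M → P))

theorem add_app (x y : Series M P) (m : Expo M) : (x + y) m = x m + y m := rfl

theorem sub_app (x y : Series M P) (m : Expo M) : (x - y) m = x m - y m := rfl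

theorem smul_app {𝕜 : Type*} [Field 𝕜] [Algebra 𝕜 P] (k : 𝕜) (x : Series M P) (m : Expo M) :
    (k • x) m = k • x m := rfl

theorem zero_app (m : Expo M) : (0 : Series M P) m = 0 := rfl

/-- The element `p ⊗ 1` for `p ∈ P`. -/
def const (p : P) : Series M P := fun m => if m = 0 then p else 0

instance : One (Series M P) := ⟨const 1⟩

/-- The product of the graded commutative algebra. -/
instance : Mul (Series M P) :=
  ⟨fun x y m => if Allowed m then
    ∑ ab ∈ Finset.HasAntidiagonal.antidiagonal m, (sgn ab.1 ab.2 : P) * (x ab.1 * y ab.2) else 0⟩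

/-- The left partial derivative by the generator `g`: it maps `g * z` to `z` if the monomial `z`
does not contain `g`, and it obeys the graded Leibniz rule. -/
def leftD (g : Gen M) (x : Series M P) : Series M P := fun m =>
  ((m g + 1 : ℕ) : P) * ((sgn (Finsupp.single g 1) m : P) * x (m + Finsupp.single g 1))

/-- The right partial derivative by the generator `g`: it maps `z * g` to `z` if the monomial `z`
does not contain `g`, and it obeys the graded Leibniz rule. -/
def rightD (g : Gen M) (x : Series M P) : Series M P := fun m =>
  ((m g + 1 : ℕ) : P) * ((sgn m (Finsupp.single g 1) : P) * x (m + Finsupp.single g 1))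

variable (𝕜 : Type*) [Field 𝕜] [Algebra 𝕜 P]

variable (M P) in
/-- The homogeneous component `X^j`. A series of degree `j` is the same as an element of the
completion `lim_p X₀^j / (F^p X₀ ∩ X₀^j)`, since only finitely many monomials of degree `j` lie
outside `F^p X₀`; see `exists_truncation` and `existsUnique_limit`. -/
def comp (j : ℤ) : Submodule 𝕜 (Series M P) where
  carrier := {x | ∀ m, x m ≠ 0 → Allowed m ∧ degree m = j}
  add_mem' := by
    intro x y hx hy m hm
    by_cases h : x m = 0
    · exact hy m (by rintro h'; exact hm (by rw [add_app, h, h', add_zero]))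
    · exact hx m h
  zero_mem' := fun m hm => absurd rfl hm
  smul_mem' := by
    intro k x hx m hm
    exact hx m (by rintro h; exact hm (by rw [smul_app, h, smul_zero]))

variable (M P) in
/-- The filtration `F^p X`: series of monomials whose factors of positive degree have total degree
at least `p`. A monomial is the product of a factor of degree `ghost m` and of one of nonpositive
degree, so that these are the limits of elements of the ideal of `X₀` generated by the elements of
degree at least `p`. In particular `filt 1` is the ideal `I`. -/
def filt (p : ℕ) : Submodule 𝕜 (Series M P) where
  carrier := {x | ∀ m, x m ≠ 0 → p ≤ ghost m}
  add_mem' := by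
    intro x y hx hy m hm
    by_cases h : x m = 0
    · exact hy m (by rintro h'; exact hm (by rw [add_app, h, h', add_zero]))
    · exact hx m h
  zero_mem' := fun m hm => absurd rfl hm
  smul_mem' := by
    intro k x hx m hm
    exact hx m (by rintro h; exact hm (by rw [smul_app, h, smul_zero]))

/-- The contribution of the pair `e i`, `e* i` to the coefficient of `z ^ m` in the bracket
of `x` and `y`. -/
def term (x y : Series M P) (m : Expo M) (i : M.ι) : P :=
  (rightD (ee i) x * leftD (es i) y) m - (-1) ^ M.deg i * (rightD (es i) x * leftD (ee i) y) m

theorem degree_add (a b : Expo M) : degree (a + b) = degree a + degree b :=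
  Finsupp.sum_add_index' (by simp) (by intros; push_cast; ring)

theorem degree_single (g : Gen M) : degree (Finsupp.single g 1) = genDeg g := by
  simp [degree, Finsupp.sum_single_index]

theorem ghost_add (a b : Expo M) : ghost (a + b) = ghost a + ghost b :=
  Finsupp.sum_add_index' (by simp) (by intros; ring)

theorem ghost_single (g : Gen M) : ghost (Finsupp.single g 1) = genGhost g := by
  simp [ghost, Finsupp.sum_single_index]

theorem genDeg_ee (i : M.ι) : genDeg (ee i) = -(M.deg i : ℤ) := rfl

theorem genDeg_es (i : M.ι) : genDeg (es i) = (M.deg i : ℤ) := rfl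

theorem genDeg_le_genGhost (g : Gen M) : genDeg g ≤ (genGhost g : ℤ) := by
  rcases h : ofLex g with i | i <;> simp [genDeg, genGhost, h]

theorem degree_le_ghost (m : Expo M) : degree m ≤ (ghost m : ℤ) := by
  simp only [degree, ghost, Finsupp.sum]
  push_cast
  exact Finset.sum_le_sum fun g _ =>
    mul_le_mul_of_nonneg_left (genDeg_le_genGhost g) (Int.natCast_nonneg _)

theorem mul_app_ne {x y : Series M P} {m : Expo M} (h : (x * y) m ≠ 0) :
    ∃ a b, a + b = m ∧ x a ≠ 0 ∧ y b ≠ 0 := by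
  by_contra! hc
  apply h
  change (if Allowed m then _ else _) = _
  split_ifs
  · refine Finset.sum_eq_zero fun ab hab => ?_
    rw [Finset.HasAntidiagonal.mem_antidiagonal] at hab
    by_cases hx : x ab.1 = 0
    · rw [hx, zero_mul, mul_zero]
    · rw [hc _ _ hab hx, mul_zero, mul_zero]
  · rfl

theorem leftD_app_ne {g : Gen M} {x : Series M P} {m : Expo M} (h : leftD g x m ≠ 0) :
    x (m + Finsupp.single g 1) ≠ 0 := fun h0 => h (by simp [leftD, h0])

theorem rightD_app_ne {g : Gen M} {x : Series M P} {m : Expo M} (h : rightD g x m ≠ 0) :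
    x (m + Finsupp.single g 1) ≠ 0 := fun h0 => h (by simp [rightD, h0])

theorem term_ne {x y : Series M P} {m : Expo M} {i : M.ι} (h : term x y m i ≠ 0) :
    ∃ a b, a + b = m ∧
      ((x (a + Finsupp.single (ee i) 1) ≠ 0 ∧ y (b + Finsupp.single (es i) 1) ≠ 0) ∨
        (x (a + Finsupp.single (es i) 1) ≠ 0 ∧ y (b + Finsupp.single (ee i) 1) ≠ 0)) := by
  by_cases h1 : (rightD (ee i) x * leftD (es i) y) m = 0
  · by_cases h2 : (rightD (es i) x * leftD (ee i) y) m = 0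
    · exact absurd (by rw [term, h1, h2, mul_zero, sub_zero]) h
    · obtain ⟨a, b, hab, ha, hb⟩ := mul_app_ne h2
      exact ⟨a, b, hab, Or.inr ⟨rightD_app_ne ha, leftD_app_ne hb⟩⟩
  · obtain ⟨a, b, hab, ha, hb⟩ := mul_app_ne h1
    exact ⟨a, b, hab, Or.inl ⟨rightD_app_ne ha, leftD_app_ne hb⟩⟩

/-- If `x` is homogeneous, the sum that defines a coefficient of `{x, y}` is finite. -/
theorem finite_terms {j : ℤ} {x : Series M P} (hx : x ∈ comp M P 𝕜 j) (y : Series M P)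
    (m : Expo M) : (Function.support (term x y m)).Finite := by
  refine Set.Finite.subset (s := ⋃ ab ∈ (Finset.HasAntidiagonal.antidiagonal m : Finset _),
    {i : M.ι | M.deg i = (degree ab.1 - j).natAbs}) ?_ ?_
  · exact Set.Finite.biUnion (Finset.finite_toSet _) fun ab _ => M.finite_deg _
  · intro i hi
    obtain ⟨a, b, hab, h⟩ := term_ne hi
    have hd : M.deg i = (degree a - j).natAbs := by
      rcases h with ⟨h, -⟩ | ⟨h, -⟩
      · have := (hx _ h).2
        rw [degree_add, degree_single, genDeg_ee] at this
        omega
      · have := (hx _ h).2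
        rw [degree_add, degree_single, genDeg_es] at this
        omega
    simp only [Set.mem_iUnion]
    exact ⟨(a, b), Finset.HasAntidiagonal.mem_antidiagonal.2 hab, hd⟩

theorem mul_add_app (x y z : Series M P) (m : Expo M) : (x * (y + z)) m = (x * y) m + (x * z) m := by
  change (if Allowed m then _ else _) = (if Allowed m then _ else _) + (if Allowed m then _ else _)
  split_ifs
  · rw [← Finset.sum_add_distrib]
    refine Finset.sum_congr rfl fun ab _ => ?_
    rw [add_app]; ring
  · rw [add_zero]

variable {𝕜} in
theorem mul_smul_app (k : 𝕜) (x y : Series M P) (m : Expo M) : (x * (k • y)) m = k • (x * y) m := by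
  change (if Allowed m then _ else _) = k • (if Allowed m then _ else _)
  split_ifs
  · rw [Finset.smul_sum]
    refine Finset.sum_congr rfl fun ab _ => ?_
    rw [smul_app, mul_smul_comm, mul_smul_comm]
  · rw [smul_zero]

theorem leftD_add (g : Gen M) (x y : Series M P) : leftD g (x + y) = leftD g x + leftD g y := by
  funext m
  rw [add_app]
  simp only [leftD, add_app]
  ring

variable {𝕜} in
theorem leftD_smul (g : Gen M) (k : 𝕜) (x : Series M P) : leftD g (k • x) = k • leftD g x := by
  funext m
  rw [smul_app]
  simp only [leftD, smul_app, mul_smul_comm]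

theorem finite_monomials (j : ℤ) (p : ℕ) : {m : Expo M | degree m = j ∧ ghost m < p}.Finite := by
  set N : ℕ := 2 * p + j.natAbs with hN
  have hS : {g : Gen M | absDeg g ≤ N}.Finite := by
    have h : (⋃ k ∈ Finset.range (N + 1), {i : M.ι | M.deg i = k}).Finite :=
      Set.Finite.biUnion (Finset.finite_toSet _) fun k _ => M.finite_deg k
    refine ((h.image ee).union (h.image es)).subset ?_
    intro g hg
    simp only [Finset.mem_range, Set.mem_union, Set.mem_image, Set.mem_iUnion, Set.mem_ofPred_eq,
      exists_prop]
    rcases hgi : ofLex g with i | i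
    · refine Or.inl ⟨i, ⟨M.deg i, ?_, rfl⟩, congrArg toLex hgi.symm⟩
      simp only [absDeg, Set.mem_ofPred_eq, hgi, Sum.elim_inl] at hg
      omega
    · refine Or.inr ⟨i, ⟨M.deg i, ?_, rfl⟩, congrArg toLex hgi.symm⟩
      simp only [absDeg, Set.mem_ofPred_eq, hgi, Sum.elim_inr] at hg
      omega
  refine (Set.finite_Icc (0 : Expo M) (Finsupp.indicator hS.toFinset fun _ _ => N)).subset ?_
  rintro m ⟨hd, hg⟩
  refine ⟨fun _ => Nat.zero_le _, fun g => ?_⟩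
  have hle : m g * absDeg g ≤ N := by
    have h1 : (m.sum fun g k => k * absDeg g : ℕ) ≤ N := by
      have h2 : ((m.sum fun g k => k * absDeg g : ℕ) : ℤ) = 2 * ghost m - degree m := by
        simp only [degree, ghost, Finsupp.sum]
        push_cast
        rw [Finset.mul_sum, ← Finset.sum_sub_distrib]
        refine Finset.sum_congr rfl fun g _ => ?_
        rcases h : ofLex g with i | i <;> simp [genDeg, genGhost, absDeg, h]
        ring
      omega
    by_cases hm : m g = 0
    · rw [hm, zero_mul]; exact Nat.zero_le _
    · exact le_trans (Finset.single_le_sum (f := fun g => m g * absDeg g)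
        (fun _ _ => Nat.zero_le _) (Finsupp.mem_support_iff.2 hm)) h1
  have hpos : 0 < absDeg g := by
    rcases h : ofLex g with i | i <;> simp [absDeg, h, M.deg_pos]
  by_cases hm : m g = 0
  · rw [hm]; exact Nat.zero_le _
  · have h1 : absDeg g ≤ N := le_trans (Nat.le_mul_of_pos_left _ (Nat.pos_of_ne_zero hm)) hle
    rw [Finsupp.indicator_apply, dif_pos (hS.mem_toFinset.2 h1)]
    exact le_trans (Nat.le_mul_of_pos_right _ hpos) hle

/-- `X₀^j` is dense: modulo `F^p X` every element of `X^j` is a finite sum of monomials. -/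
theorem exists_truncation {j : ℤ} {x : Series M P} (hx : x ∈ comp M P 𝕜 j) (p : ℕ) :
    ∃ y ∈ comp M P 𝕜 j, (Function.support y).Finite ∧ x - y ∈ filt M P 𝕜 p := by
  refine ⟨fun m => if ghost m < p then x m else 0, ?_, ?_, ?_⟩
  · intro m hm
    exact hx m fun h => hm (by simp [h])
  · refine (finite_monomials (M := M) j p).subset fun m hm => ?_
    rw [Function.mem_support] at hm
    split_ifs at hm with h
    · exact ⟨(hx m hm).2, h⟩
    · exact absurd rfl hm
  · intro m hm
    by_contra h
    exact hm (by
      change x m - (if ghost m < p then x m else 0) = 0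
      rw [if_pos (not_le.1 h), sub_self])

/-- `X^j` is complete: every element of the inverse limit of the spaces `X₀^j / F^p X₀^j` comes
from a unique element of `X^j`. -/
theorem existsUnique_limit {j : ℤ} (x : ℕ → Series M P) (hx : ∀ p, x p ∈ comp M P 𝕜 j)
    (h : ∀ p q, p ≤ q → x q - x p ∈ filt M P 𝕜 p) :
    ∃! y, y ∈ comp M P 𝕜 j ∧ ∀ p, y - x p ∈ filt M P 𝕜 p := by
  refine ⟨fun m => x (ghost m + 1) m, ⟨fun m hm => hx _ m hm, fun p m hm => ?_⟩, ?_⟩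
  · by_contra hp
    exact (h (ghost m + 1) p (by omega) m (fun h0 => hm (by
      change x (ghost m + 1) m - x p m = 0
      rw [← neg_sub, ← sub_app, h0, neg_zero]))).not_gt (Nat.lt_succ_self _)
  · rintro y ⟨-, hy⟩
    funext m
    by_contra hm
    exact (hy (ghost m + 1) m (fun h0 => hm (sub_eq_zero.1 h0))).not_gt (Nat.lt_succ_self _)

variable [PoissonAlgebra 𝕜 P]

/-- The extension of the bracket of `P` that treats all generators as constants:
`{p z^a, q z^b}₀ = {p, q} z^a z^b`. -/
def bracketP (x y : Series M P) : Series M P := fun m =>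
  if Allowed m then
    ∑ ab ∈ Finset.HasAntidiagonal.antidiagonal m, (sgn ab.1 ab.2 : P) * pbr 𝕜 (x ab.1) (y ab.2) else 0

/-- The bracket on `X`. It is the sum of `bracketP` and of the graded biderivation which vanishes
on `P` and whose only nonzero values on generators are
`{e i, e* i} = 1` and `{e* i, e i} = -(-1) ^ (deg (e i) * deg (e* i)) = -(-1) ^ deg i`.
For homogeneous `x` each coefficient is a finite sum, see `finite_terms`. -/
def bracket (x y : Series M P) : Series M P := fun m =>
  bracketP 𝕜 x y m + ∑ᶠ i : M.ι, term x y m i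

theorem bracket_app (x y : Series M P) (m : Expo M) :
    bracket 𝕜 x y m = bracketP 𝕜 x y m + ∑ᶠ i : M.ι, term x y m i := rfl

/-- The differential `d_R = {R, -}` for `R ∈ X^1`. -/
def dR (R : comp M P 𝕜 1) : Series M P →ₗ[𝕜] Series M P where
  toFun := bracket 𝕜 R.1
  map_add' := by
    intro x y
    funext m
    rw [add_app, bracket_app, bracket_app, bracket_app]
    have h1 : bracketP 𝕜 R.1 (x + y) m = bracketP 𝕜 R.1 x m + bracketP 𝕜 R.1 y m := by
      simp only [bracketP]
      split_ifs
      · rw [← Finset.sum_add_distrib]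
        refine Finset.sum_congr rfl fun ab _ => ?_
        rw [add_app, Reduction.pbr_add_right, mul_add]
      · rw [add_zero]
    have h2 : ∑ᶠ i, term R.1 (x + y) m i = ∑ᶠ i, term R.1 x m i + ∑ᶠ i, term R.1 y m i := by
      rw [← finsum_add_distrib (finite_terms 𝕜 R.2 x m) (finite_terms 𝕜 R.2 y m)]
      refine finsum_congr fun i => ?_
      simp only [term, leftD_add, mul_add_app]
      ring
    rw [h1, h2]
    ring
  map_smul' := by
    intro k x
    funext m
    rw [RingHom.id_apply, smul_app, bracket_app, bracket_app]
    have h1 : bracketP 𝕜 R.1 (k • x) m = k • bracketP 𝕜 R.1 x m := by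
      simp only [bracketP]
      split_ifs
      · rw [Finset.smul_sum]
        refine Finset.sum_congr rfl fun ab _ => ?_
        rw [smul_app, Reduction.pbr_smul_right, mul_smul_comm]
      · rw [smul_zero]
    have h2 : ∑ᶠ i, term R.1 (k • x) m i = k • ∑ᶠ i, term R.1 x m i := by
      rw [smul_finsum' k (finite_terms 𝕜 R.2 x m)]
      refine finsum_congr fun i => ?_
      simp only [term, leftD_smul, mul_smul_app, smul_sub, mul_smul_comm]
    rw [h1, h2, smul_add]

theorem bracketP_app_ne {x y : Series M P} {m : Expo M} (h : bracketP 𝕜 x y m ≠ 0) :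
    ∃ a b, a + b = m ∧ x a ≠ 0 ∧ y b ≠ 0 := by
  by_contra! hc
  apply h
  simp only [bracketP]
  split_ifs
  · refine Finset.sum_eq_zero fun ab hab => ?_
    rw [Finset.HasAntidiagonal.mem_antidiagonal] at hab
    by_cases hx : x ab.1 = 0
    · rw [hx, Reduction.pbr_zero_left, mul_zero]
    · rw [hc _ _ hab hx, Reduction.pbr_zero_right, mul_zero]
  · rfl

theorem bracket_app_ne {x y : Series M P} {m : Expo M} (h : bracket 𝕜 x y m ≠ 0) :
    (∃ a b, a + b = m ∧ x a ≠ 0 ∧ y b ≠ 0) ∨ ∃ i, term x y m i ≠ 0 := by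
  by_contra! hc
  apply h
  have h1 : bracketP 𝕜 x y m = 0 := by
    by_contra h1
    obtain ⟨a, b, hab, ha, hb⟩ := bracketP_app_ne 𝕜 h1
    exact hb (hc.1 a b hab ha)
  rw [bracket_app, h1, finsum_congr hc.2, finsum_zero, add_zero]

/-- The differential `d_R` preserves the ideal `I`. -/
theorem dR_filt (R : comp M P 𝕜 1) : filt M P 𝕜 1 ≤ (filt M P 𝕜 1).comap (dR 𝕜 R) := by
  intro x hx m hm
  by_contra hg
  have hg0 : ghost m = 0 := by omega
  rcases bracket_app_ne 𝕜 hm with ⟨a, b, hab, -, hb⟩ | ⟨i, hi⟩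
  · have := hx b hb
    rw [← hab, ghost_add] at hg0
    omega
  · obtain ⟨a, b, hab, ⟨h, -⟩ | ⟨-, h⟩⟩ := term_ne hi
    · rw [← hab, ghost_add] at hg0
      have h1 := (R.2 _ h).2
      have h2 := degree_le_ghost a
      rw [degree_add, degree_single, genDeg_ee] at h1
      omega
    · rw [← hab, ghost_add] at hg0
      have h1 := hx _ h
      rw [ghost_add, ghost_single] at h1
      have h2 : genGhost (ee i) = 0 := rfl
      omega

/-- The differential induced by `d_R` on `X/I`. -/
def dRbar (R : comp M P 𝕜 1) : (Series M P ⧸ filt M P 𝕜 1) →ₗ[𝕜] (Series M P ⧸ filt M P 𝕜 1) :=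
  Submodule.mapQ _ _ (dR 𝕜 R) (dR_filt 𝕜 R)

variable (M P) in
/-- The homogeneous component `(X/I)^j`, the image of `X^j`. -/
def compBar (j : ℤ) : Submodule 𝕜 (Series M P ⧸ filt M P 𝕜 1) :=
  (comp M P 𝕜 j).map (filt M P 𝕜 1).mkQ

end Series

/-! # Cohomology -/

section Cohomology

variable {𝕜 C : Type*} [Field 𝕜] [AddCommGroup C] [Module 𝕜 C]

/-- The cocycles of degree `j` of the complex with components `𝒜 j` and differential `D`. -/
def cocycles (D : C →ₗ[𝕜] C) (𝒜 : ℤ → Submodule 𝕜 C) (j : ℤ) : Submodule 𝕜 C :=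
  𝒜 j ⊓ LinearMap.ker D

/-- The coboundaries of degree `j` of the complex with components `𝒜 j` and differential `D`. -/
def coboundaries (D : C →ₗ[𝕜] C) (𝒜 : ℤ → Submodule 𝕜 C) (j : ℤ) : Submodule 𝕜 C :=
  (𝒜 (j - 1)).map D

/-- The cohomology in degree `j` of the complex with components `𝒜 j` and differential `D`. -/
abbrev Cohomology (D : C →ₗ[𝕜] C) (𝒜 : ℤ → Submodule 𝕜 C) (j : ℤ) : Type _ :=
  cocycles D 𝒜 j ⧸ (coboundaries D 𝒜 j).submoduleOf (cocycles D 𝒜 j)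

end Cohomology

/-! # BFV models -/

section Model

variable (𝕜 : Type*) {P : Type*} [Field 𝕜] [CommRing P] [Algebra 𝕜 P]

theorem const_comp (p : P) : (const p : Series M P) ∈ comp M P 𝕜 0 := by
  intro m hm
  have h : m = 0 := by
    by_contra h
    exact hm (by simp [const, h])
  subst h
  exact ⟨fun g _ => Nat.zero_le _, by simp [degree]⟩

variable [PoissonAlgebra 𝕜 P]

theorem dR_const (R : comp M P 𝕜 1) (p : P) : dR 𝕜 R (const p) ∈ filt M P 𝕜 1 := by
  intro m hm
  by_contra hg
  have hg0 : ghost m = 0 := by omega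
  rcases bracket_app_ne 𝕜 hm with ⟨a, b, hab, ha, -⟩ | ⟨i, hi⟩
  · have h1 := (R.2 _ ha).2
    have h2 := degree_le_ghost a
    rw [← hab, ghost_add] at hg0
    omega
  · have hz : ∀ (g : Gen M) (b : Expo M),
        (const p : Series M P) (b + Finsupp.single g 1) = 0 := by
      intro g b
      have : b + Finsupp.single g 1 ≠ 0 := by
        intro h
        have := DFunLike.congr_fun h g
        simp at this
      simp [const, this]
    obtain ⟨a, b, -, ⟨-, h⟩ | ⟨-, h⟩⟩ := term_ne hi
    · exact h (hz _ _)
    · exact h (hz _ _)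

/-- The natural map `P → H^0(X/I, d_R)`, sending `p` to the class of `p ⊗ 1`. -/
def natMap (R : comp M P 𝕜 1) : P →ₗ[𝕜] Cohomology (dRbar 𝕜 R) (compBar M P 𝕜) 0 :=
  (Submodule.mkQ _).comp
    { toFun := fun p => ⟨(filt M P 𝕜 1).mkQ (const p),
        ⟨const p, const_comp 𝕜 p, rfl⟩, by
          change dRbar 𝕜 R ((filt M P 𝕜 1).mkQ (const p)) = 0
          rw [dRbar, Submodule.mkQ_apply, Submodule.mapQ_apply]
          exact (Submodule.Quotient.mk_eq_zero _).2 (dR_const 𝕜 R p)⟩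
      map_add' := by
        intro p q
        apply Subtype.ext
        have : (const (p + q) : Series M P) = const p + const q := by
          funext m
          rw [add_app]
          by_cases h : m = 0 <;> simp [const, h]
        change (filt M P 𝕜 1).mkQ (const (p + q)) = _
        rw [this, map_add]
        rfl
      map_smul' := by
        intro k p
        apply Subtype.ext
        have : (const (k • p) : Series M P) = k • const p := by
          funext m
          rw [smul_app]
          by_cases h : m = 0 <;> simp [const, h]
        change (filt M P 𝕜 1).mkQ (const (k • p)) = _
        rw [this, map_smul, RingHom.id_apply]
        rfl }

/-- `(X, R)` is a BFV model for `P` and `J`: `R ∈ X^1` solves the classical master equation, the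
complex `(X/I, d_R)` has no cohomology in nonzero degrees, and `H^0(X/I, d_R) = P/J`, that is, the
natural map `P → H^0(X/I, d_R)` is surjective with kernel `J`. -/
structure IsBFVModel (J : Ideal P) (R : comp M P 𝕜 1) : Prop where
  master : bracket 𝕜 R.1 R.1 = 0
  acyclic : ∀ j : ℤ, j ≠ 0 → Subsingleton (Cohomology (dRbar 𝕜 R) (compBar M P 𝕜) j)
  surjective : Function.Surjective (natMap 𝕜 R)
  kernel : ∀ p : P, natMap 𝕜 R p = 0 ↔ p ∈ J

/-- The degree zero cohomology `H^0(X, d_R)`. -/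
abbrev H0 (R : comp M P 𝕜 1) : Type _ := Cohomology (dR 𝕜 R) (comp M P 𝕜) 0

/-- The class in `H^0(X, d_R)` of a cocycle. -/
def H0.mk (R : comp M P 𝕜 1) (x : cocycles (dR 𝕜 R) (comp M P 𝕜) 0) : H0 𝕜 R :=
  Submodule.Quotient.mk x

end Model

/-- The structure of a (commutative, unital) Poisson algebra on a vector space. -/
structure PoissonStructure (𝕜 H : Type*) [Field 𝕜] [AddCommGroup H] [Module 𝕜 H] where
  one : H
  mul : H →ₗ[𝕜] H →ₗ[𝕜] H
  bracket : H →ₗ[𝕜] H →ₗ[𝕜] H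
  mul_assoc : ∀ a b c, mul (mul a b) c = mul a (mul b c)
  mul_comm : ∀ a b, mul a b = mul b a
  one_mul : ∀ a, mul one a = a
  bracket_self : ∀ a, bracket a a = 0
  jacobi : ∀ a b c, bracket a (bracket b c) = bracket (bracket a b) c + bracket b (bracket a c)
  leibniz : ∀ a b c, bracket a (mul b c) = mul (bracket a b) c + mul b (bracket a c)

end BFV

end

/-!
The complex `(X, d_R)` is filtered by the `F^p X`. On `F^p X / F^(p+1) X` the differential `d_R`
acts on the coefficients of the monomials in the `e* i` of degree `p`, which are elements of `X/I`,
by the differential of `X/I` (`BFV.dR_app_add`). As `X/I` is a resolution of `P/J`, the cohomology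
of `F^p X / F^(p+1) X` is concentrated in degree `p`, and since `X` is complete, a closed element of
`F^p X` of degree less than `p` is exact (`BFV.IsBFVModel.exists_dR_eq`). Hence a cocycle `x` of
degree zero is determined up to coboundaries by its constant term modulo `J`
(`BFV.IsBFVModel.exists_coboundary`), and `p ∈ P` is the constant term of a cocycle as soon as the
terms of order one of `d_R p`, which are `∑ i, {R (e* i), p} e* i`, vanish modulo `J`
(`BFV.IsBFVModel.exists_cocycle`). The coefficients `R (e* i)` of `R` generate `J`
(`BFV.IsBFVModel.le_span`), so that the last condition means that `{p, J} ⊆ J`.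

The structure of a Poisson algebra on `H^0(X, d_R)` is transported from `(P/J)^J`. It is induced by
the operations of `X`, since the constant terms of `x * y` and `{x, y}` are the product and the
bracket of the constant terms, once it is known that `x * y` and `{x, y}` are cocycles if `x` and
`y` are. For this and for `d_R ∘ d_R = 0` one needs the graded Leibniz rule and the graded Jacobi
identity in `X`. The bracket of `X` is assembled from the bracket of `P` and from the commuting
derivatives by the generators. For finitely many pairs of generators the identities follow from a
formal computation with derivations (`BFV.HamiltonianData.br_jacobi`), and each coefficient of an
iterated bracket of homogeneous series involves only finitely many pairs of generators.
-/

namespace BFV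

/-! ### Graded Poisson brackets from commuting derivations -/

/-- The Koszul sign `(-1) ^ (p * q)` of two parities. -/
def koszul (p q : ZMod 2) : ℤ := if p = 1 ∧ q = 1 then -1 else 1

/-- A graded commutative ring with a graded Poisson bracket `B` and with graded commuting
derivations `D k` of the product and of `B`, which come in pairs `k`, `dual k`. The homogeneous
elements of parity `p` are those of `𝒜 p`, and `ω` is the graded skew pairing of `k` with
`dual k`. -/
structure HamiltonianData (A K : Type*) [NonUnitalRing A] where
  𝒜 : ZMod 2 → AddSubgroup A
  mul_mem : ∀ {p q x y}, x ∈ 𝒜 p → y ∈ 𝒜 q → x * y ∈ 𝒜 (p + q)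
  mul_comm : ∀ {p q x y}, x ∈ 𝒜 p → y ∈ 𝒜 q → x * y = koszul p q • (y * x)
  dual : Equiv.Perm K
  dual_dual : ∀ k, dual (dual k) = k
  par : K → ZMod 2
  par_dual : ∀ k, par (dual k) = par k
  ω : K → ℤ
  ω_dual : ∀ k, ω (dual k) = -koszul (par k) (par k) * ω k
  D : K → A →+ A
  D_mem : ∀ {p x} k, x ∈ 𝒜 p → D k x ∈ 𝒜 (p + par k)
  D_mul : ∀ {p q x y} k, x ∈ 𝒜 p → y ∈ 𝒜 q →
    D k (x * y) = D k x * y + koszul (par k) p • (x * D k y)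
  D_comm : ∀ {p x} k l, x ∈ 𝒜 p → D k (D l x) = koszul (par k) (par l) • D l (D k x)
  B : A →+ A →+ A
  B_mem : ∀ {p q x y}, x ∈ 𝒜 p → y ∈ 𝒜 q → B x y ∈ 𝒜 (p + q)
  B_skew : ∀ {p q x y}, x ∈ 𝒜 p → y ∈ 𝒜 q → B x y = -koszul p q • B y x
  B_leibniz : ∀ {p q r x y z}, x ∈ 𝒜 p → y ∈ 𝒜 q → z ∈ 𝒜 r →
    B x (y * z) = B x y * z + koszul p q • (y * B x z)
  B_jacobi : ∀ {p q r x y z}, x ∈ 𝒜 p → y ∈ 𝒜 q → z ∈ 𝒜 r →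
    B x (B y z) = B (B x y) z + koszul p q • B y (B x z)
  D_B : ∀ {p q x y} k, x ∈ 𝒜 p → y ∈ 𝒜 q →
    D k (B x y) = B (D k x) y + koszul (par k) p • B x (D k y)

namespace HamiltonianData

section

variable {A K : Type*} [NonUnitalRing A] {H : HamiltonianData A K} {p q r : ZMod 2} {x y z : A}

theorem D_dual_mem (k : K) (hx : x ∈ H.𝒜 p) : H.D (H.dual k) x ∈ H.𝒜 (p + H.par k) := by
  have := H.D_mem (H.dual k) hx
  rwa [H.par_dual] at this

theorem B_leibniz_left (hx : x ∈ H.𝒜 p) (hy : y ∈ H.𝒜 q) (hz : z ∈ H.𝒜 r) :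
    H.B (x * y) z = x * H.B y z + koszul q r • (H.B x z * y) := by
  rw [H.B_skew (H.mul_mem hx hy) hz, H.B_leibniz hz hx hy, H.B_skew hz hx, H.B_skew hz hy]
  simp only [smul_mul_assoc, mul_smul_comm, smul_add, smul_smul]
  rw [add_comm]
  have e1 : -koszul (p + q) r * (koszul r p * -koszul r q) = 1 := by clear * -; revert p q r; decide
  have e2 : -koszul (p + q) r * -koszul r p = koszul q r := by clear * -; revert p q r; decide
  rw [e1, e2, one_smul]

end

variable {A K : Type*} [NonUnitalRing A] [Fintype K] (H : HamiltonianData A K)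

/-- The coefficient of `D k x * D (dual k) y` in the bracket of `x` and `y`, for `x` of
parity `p`. -/
def coef (k : K) (p : ZMod 2) : ℤ := koszul (H.par k) (p + H.par k) * H.ω k

/-- The part of the bracket given by the derivations `D k`, for `x` of parity `p`. -/
def symp (p : ZMod 2) (x y : A) : A := ∑ k, H.coef k p • (H.D k x * H.D (H.dual k) y)

/-- The bracket `B x y + ∑ k, ± D k x * D (dual k) y`, for `x` of parity `p`. -/
def br (p : ZMod 2) (x y : A) : A := H.B x y + H.symp p x y

variable {H} {p q r : ZMod 2} {x y z : A}

theorem symp_mem (hx : x ∈ H.𝒜 p) (hy : y ∈ H.𝒜 q) : H.symp p x y ∈ H.𝒜 (p + q) := by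
  refine AddSubgroup.sum_mem _ fun k _ => AddSubgroup.zsmul_mem _ ?_ _
  have h := H.mul_mem (H.D_mem k hx) (D_dual_mem k hy)
  have e : p + H.par k + (q + H.par k) = p + q := by
    generalize H.par k = a
    clear * -
    revert p q a
    decide
  rwa [e] at h

theorem symp_symp_right (hy : y ∈ H.𝒜 q) (hz : z ∈ H.𝒜 r) :
    H.symp p x (H.symp q y z) =
      ∑ k, ∑ l, (H.coef k p * H.coef l q) •
        (H.D k x * H.D (H.dual k) (H.D l y) * H.D (H.dual l) z) +
      ∑ k, ∑ l, (H.coef k p * H.coef l q * koszul (H.par k) (q + H.par l)) •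
        (H.D k x * H.D l y * H.D (H.dual k) (H.D (H.dual l) z)) := by
  rw [← Finset.sum_add_distrib]
  refine Finset.sum_congr rfl fun k _ => ?_
  rw [← Finset.sum_add_distrib, symp, map_sum, Finset.mul_sum, Finset.smul_sum]
  refine Finset.sum_congr rfl fun l _ => ?_
  rw [map_zsmul, H.D_mul _ (H.D_mem l hy) (D_dual_mem l hz), H.par_dual]
  simp only [mul_add, mul_smul_comm, smul_add, smul_smul, mul_assoc]

theorem symp_symp_left (hx : x ∈ H.𝒜 p) (hy : y ∈ H.𝒜 q) :
    H.symp (p + q) (H.symp p x y) z =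
      ∑ k, ∑ l, (H.coef k (p + q) * H.coef l p) •
        (H.D k (H.D l x) * H.D (H.dual l) y * H.D (H.dual k) z) +
      ∑ k, ∑ l, (H.coef k (p + q) * H.coef l p * koszul (H.par k) (p + H.par l)) •
        (H.D l x * H.D k (H.D (H.dual l) y) * H.D (H.dual k) z) := by
  rw [← Finset.sum_add_distrib]
  refine Finset.sum_congr rfl fun k _ => ?_
  rw [← Finset.sum_add_distrib]
  conv_lhs => rw [symp]
  rw [map_sum, Finset.sum_mul, Finset.smul_sum]
  refine Finset.sum_congr rfl fun l _ => ?_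
  rw [map_zsmul, H.D_mul _ (H.D_mem l hx) (D_dual_mem l hy)]
  simp only [add_mul, smul_mul_assoc, smul_add, smul_smul, mul_assoc]

/-- The bracket given by commuting derivations satisfies the Jacobi identity. -/
theorem symp_jacobi (hx : x ∈ H.𝒜 p) (hy : y ∈ H.𝒜 q) (hz : z ∈ H.𝒜 r) :
    H.symp p x (H.symp q y z) =
      H.symp (p + q) (H.symp p x y) z + koszul p q • H.symp q y (H.symp p x z) := by
  rw [symp_symp_right hy hz, symp_symp_left hx hy, symp_symp_right hx hz]
  -- the terms with a second derivative of `y`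
  have h1 : ∑ k, ∑ l, (H.coef k p * H.coef l q) •
        (H.D k x * H.D (H.dual k) (H.D l y) * H.D (H.dual l) z) =
      ∑ k, ∑ l, (H.coef k (p + q) * H.coef l p * koszul (H.par k) (p + H.par l)) •
        (H.D l x * H.D k (H.D (H.dual l) y) * H.D (H.dual k) z) := by
    rw [Finset.sum_comm]
    refine Finset.sum_congr rfl fun l _ => Finset.sum_congr rfl fun k _ => ?_
    rw [H.D_comm l (H.dual k) hy, H.par_dual, mul_smul_comm, smul_mul_assoc, smul_smul]
    congr 1
    have key : koszul (H.par l) (q + H.par l) = koszul (H.par l) (p + q + H.par l) *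
        koszul (H.par l) (p + H.par k) * koszul (H.par l) (H.par k) := by
      generalize H.par l = a
      generalize H.par k = b
      clear * -
      revert p q a b
      decide
    simp only [coef]
    linear_combination koszul (H.par k) (p + H.par k) * H.ω k * H.ω l * key
  -- the terms with a second derivative of `z`
  have h2 : ∑ k, ∑ l, (H.coef k p * H.coef l q * koszul (H.par k) (q + H.par l)) •
        (H.D k x * H.D l y * H.D (H.dual k) (H.D (H.dual l) z)) =
      koszul p q • ∑ k, ∑ l, (H.coef k q * H.coef l p * koszul (H.par k) (p + H.par l)) •
        (H.D k y * H.D l x * H.D (H.dual k) (H.D (H.dual l) z)) := by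
    rw [Finset.smul_sum, Finset.sum_comm]
    refine Finset.sum_congr rfl fun l _ => ?_
    rw [Finset.smul_sum]
    refine Finset.sum_congr rfl fun k _ => ?_
    rw [H.mul_comm (H.D_mem k hx) (H.D_mem l hy), H.D_comm (H.dual k) (H.dual l) hz,
      H.par_dual, H.par_dual, mul_smul_comm, smul_mul_assoc, smul_smul, smul_smul, smul_smul]
    congr 1
    have key : koszul (H.par k) (q + H.par l) * koszul (H.par k) (H.par l) *
        koszul (p + H.par k) (q + H.par l) = koszul p q * koszul (H.par l) (p + H.par k) := by
      generalize H.par l = a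
      generalize H.par k = b
      clear * -
      revert p q a b
      decide
    linear_combination H.coef k p * H.coef l q * key
  -- the terms with a second derivative of `x`, where `l` and `dual l` change their places
  have h3 : ∑ k, ∑ l, (H.coef k (p + q) * H.coef l p) •
        (H.D k (H.D l x) * H.D (H.dual l) y * H.D (H.dual k) z) +
      koszul p q • ∑ k, ∑ l, (H.coef k q * H.coef l p) •
        (H.D k y * H.D (H.dual k) (H.D l x) * H.D (H.dual l) z) = 0 := by
    rw [Finset.sum_comm (f := fun k l => (H.coef k q * H.coef l p) •
        (H.D k y * H.D (H.dual k) (H.D l x) * H.D (H.dual l) z)), Finset.smul_sum,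
      ← Finset.sum_add_distrib]
    refine Finset.sum_eq_zero fun k _ => ?_
    rw [← Equiv.sum_comp H.dual (fun l => (H.coef l q * H.coef k p) •
        (H.D l y * H.D (H.dual l) (H.D k x) * H.D (H.dual k) z)), Finset.smul_sum,
      ← Finset.sum_add_distrib]
    refine Finset.sum_eq_zero fun l _ => ?_
    rw [H.dual_dual, H.mul_comm (D_dual_mem l hy) (H.D_mem l (H.D_mem k hx)), H.D_comm k l hx]
    simp only [smul_mul_assoc, smul_smul]
    rw [← add_smul]
    convert zero_smul ℤ _
    have key : koszul (H.par k) (p + q + H.par k) * koszul (H.par l) (p + H.par l) *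
        koszul (H.par k) (H.par l) = koszul p q * koszul (H.par l) (q + H.par l) *
        koszul (H.par l) (H.par l) * koszul (H.par k) (p + H.par k) *
        koszul (q + H.par l) (p + H.par k + H.par l) := by
      generalize H.par l = a
      generalize H.par k = b
      clear * -
      revert p q a b
      decide
    simp only [coef, H.ω_dual, H.par_dual]
    linear_combination H.ω k * H.ω l * key
  rw [h1, h2, smul_add]
  linear_combination (norm := abel) -h3

/-- The mixed terms of the Jacobi identity cancel, since the `D k` are derivations of `B`. -/
theorem mixed_jacobi (hx : x ∈ H.𝒜 p) (hy : y ∈ H.𝒜 q) (hz : z ∈ H.𝒜 r) :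
    H.B x (H.symp q y z) + H.symp p x (H.B y z) =
      H.B (H.symp p x y) z + H.symp (p + q) (H.B x y) z +
        koszul p q • (H.B y (H.symp p x z) + H.symp q y (H.B x z)) := by
  have hr : ∀ {p q r : ZMod 2} {x y z : A}, x ∈ H.𝒜 p → y ∈ H.𝒜 q → z ∈ H.𝒜 r →
      H.B x (H.symp q y z) + H.symp p x (H.B y z) =
        ∑ k, (H.coef k q • (H.B x (H.D k y) * H.D (H.dual k) z) +
          (H.coef k q * koszul p (q + H.par k)) • (H.D k y * H.B x (H.D (H.dual k) z)) +
          (H.coef k p • (H.D k x * H.B (H.D (H.dual k) y) z) +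
          (H.coef k p * koszul (H.par k) q) • (H.D k x * H.B y (H.D (H.dual k) z)))) := by
    intro p q r x y z hx hy hz
    rw [symp, symp, map_sum, ← Finset.sum_add_distrib]
    refine Finset.sum_congr rfl fun k _ => ?_
    rw [map_zsmul, H.B_leibniz hx (H.D_mem k hy) (D_dual_mem k hz), H.D_B _ hy hz, H.par_dual,
      mul_add, mul_smul_comm, smul_add, smul_add, smul_smul, smul_smul]
  have hl : H.B (H.symp p x y) z + H.symp (p + q) (H.B x y) z =
        ∑ k, (H.coef k p • (H.D k x * H.B (H.D (H.dual k) y) z) +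
          (H.coef k p * koszul (q + H.par k) r) • (H.B (H.D k x) z * H.D (H.dual k) y) +
          (H.coef k (p + q) • (H.B (H.D k x) y * H.D (H.dual k) z) +
          (H.coef k (p + q) * koszul (H.par k) p) •
            (H.B x (H.D k y) * H.D (H.dual k) z))) := by
    rw [symp, symp, map_sum, AddMonoidHom.finsetSum_apply, ← Finset.sum_add_distrib]
    refine Finset.sum_congr rfl fun k _ => ?_
    rw [map_zsmul, AddMonoidHom.zsmul_apply, B_leibniz_left (H.D_mem k hx) (D_dual_mem k hy) hz,
      H.D_B _ hx hy, add_mul, smul_mul_assoc, smul_add, smul_add, smul_smul, smul_smul]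
  rw [hr hx hy hz, hl, hr hy hx hz]
  simp only [Finset.sum_add_distrib, smul_add]
  have h1 : ∑ k, H.coef k q • (H.B x (H.D k y) * H.D (H.dual k) z) =
      ∑ k, (H.coef k (p + q) * koszul (H.par k) p) • (H.B x (H.D k y) * H.D (H.dual k) z) := by
    refine Finset.sum_congr rfl fun k _ => ?_
    congr 1
    have key : koszul (H.par k) (q + H.par k) =
        koszul (H.par k) (p + q + H.par k) * koszul (H.par k) p := by
      generalize H.par k = a
      clear * -
      revert p q a
      decide
    simp only [coef]
    linear_combination H.ω k * key
  have h2 : ∑ k, (H.coef k q * koszul p (q + H.par k)) • (H.D k y * H.B x (H.D (H.dual k) z)) =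
      koszul p q • ∑ k, (H.coef k q * koszul (H.par k) p) •
        (H.D k y * H.B x (H.D (H.dual k) z)) := by
    rw [Finset.smul_sum]
    refine Finset.sum_congr rfl fun k _ => ?_
    rw [smul_smul]
    congr 1
    have key : koszul p (q + H.par k) = koszul p q * koszul (H.par k) p := by
      generalize H.par k = a
      clear * -
      revert p q a
      decide
    linear_combination H.coef k q * key
  have h3 : ∑ k, (H.coef k p * koszul (H.par k) q) • (H.D k x * H.B y (H.D (H.dual k) z)) =
      koszul p q • ∑ k, (H.coef k p * koszul q (p + H.par k)) •
        (H.D k x * H.B y (H.D (H.dual k) z)) := by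
    rw [Finset.smul_sum]
    refine Finset.sum_congr rfl fun k _ => ?_
    rw [smul_smul]
    congr 1
    have key : koszul (H.par k) q = koszul p q * koszul q (p + H.par k) := by
      generalize H.par k = a
      clear * -
      revert p q a
      decide
    linear_combination H.coef k p * key
  have h4 : ∑ k, H.coef k (p + q) • (H.B (H.D k x) y * H.D (H.dual k) z) +
      koszul p q • ∑ k, H.coef k p • (H.B y (H.D k x) * H.D (H.dual k) z) = 0 := by
    rw [Finset.smul_sum, ← Finset.sum_add_distrib]
    refine Finset.sum_eq_zero fun k _ => ?_
    rw [H.B_skew (H.D_mem k hx) hy, smul_mul_assoc, smul_smul, smul_smul, ← add_smul]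
    convert zero_smul ℤ _
    have key : koszul (H.par k) (p + q + H.par k) * koszul (p + H.par k) q =
        koszul p q * koszul (H.par k) (p + H.par k) := by
      generalize H.par k = a
      clear * -
      revert p q a
      decide
    simp only [coef]
    linear_combination -H.ω k * key
  have h5 : ∑ k, (H.coef k p * koszul (q + H.par k) r) •
        (H.B (H.D k x) z * H.D (H.dual k) y) +
      koszul p q • ∑ k, H.coef k q • (H.D k y * H.B (H.D (H.dual k) x) z) = 0 := by
    rw [← Equiv.sum_comp H.dual (fun k => H.coef k q •
      (H.D k y * H.B (H.D (H.dual k) x) z)), Finset.smul_sum, ← Finset.sum_add_distrib]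
    refine Finset.sum_eq_zero fun k _ => ?_
    rw [H.dual_dual, H.mul_comm (D_dual_mem k hy) (H.B_mem (H.D_mem k hx) hz), smul_smul,
      smul_smul, ← add_smul]
    convert zero_smul ℤ _
    have key : koszul (H.par k) (p + H.par k) * koszul (q + H.par k) r =
        koszul p q * koszul (H.par k) (q + H.par k) * koszul (H.par k) (H.par k) *
          koszul (q + H.par k) (p + H.par k + r) := by
      generalize H.par k = a
      clear * -
      revert p q r a
      decide
    simp only [coef, H.ω_dual, H.par_dual]
    linear_combination H.ω k * key
  rw [h1, h2, h3]
  linear_combination (norm := abel) -h4 - h5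

/-- The graded Jacobi identity. -/
theorem br_jacobi (hx : x ∈ H.𝒜 p) (hy : y ∈ H.𝒜 q) (hz : z ∈ H.𝒜 r) :
    H.br p x (H.br q y z) =
      H.br (p + q) (H.br p x y) z + koszul p q • H.br q y (H.br p x z) := by
  have hadd : ∀ (p : ZMod 2) (x u v : A), H.symp p x (u + v) = H.symp p x u + H.symp p x v := by
    intro p x u v
    simp only [symp, map_add, mul_add, smul_add, Finset.sum_add_distrib]
  have hadd' : ∀ (p : ZMod 2) (u v x : A), H.symp p (u + v) x = H.symp p u x + H.symp p v x := by
    intro p u v x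
    simp only [symp, map_add, add_mul, smul_add, Finset.sum_add_distrib]
  simp only [br, map_add, hadd, hadd', AddMonoidHom.add_apply, smul_add]
  have h1 := mixed_jacobi hx hy hz
  rw [smul_add] at h1
  have h2 := symp_jacobi hx hy hz
  have h3 := H.B_jacobi hx hy hz
  linear_combination (norm := abel) h1 + h2 + h3

/-- The graded Leibniz rule. -/
theorem br_leibniz (hx : x ∈ H.𝒜 p) (hy : y ∈ H.𝒜 q) (hz : z ∈ H.𝒜 r) :
    H.br p x (y * z) = H.br p x y * z + koszul p q • (y * H.br p x z) := by
  have h1 : H.symp p x (y * z) = H.symp p x y * z + koszul p q • (y * H.symp p x z) := by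
    rw [symp, symp, symp, Finset.sum_mul, Finset.mul_sum, Finset.smul_sum,
      ← Finset.sum_add_distrib]
    refine Finset.sum_congr rfl fun k _ => ?_
    rw [H.D_mul _ hy hz, H.par_dual, mul_add, smul_add, smul_mul_assoc, mul_assoc,
      mul_smul_comm, mul_smul_comm, ← mul_assoc, ← mul_assoc,
      H.mul_comm (H.D_mem k hx) hy, smul_mul_assoc, smul_smul, smul_smul, smul_smul,
      mul_assoc, mul_assoc, mul_assoc]
    congr 2
    have key : koszul (H.par k) q * koszul (p + H.par k) q = koszul p q := by
      generalize H.par k = a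
      clear * -
      revert p q a
      decide
    linear_combination H.coef k p * key
  rw [br, br, br, H.B_leibniz hx hy hz, h1, add_mul, mul_add, smul_add]
  abel

end HamiltonianData
end BFV

namespace BFV
variable {M : GhostBasis}

/-! ### Signs -/

/-- The parity of a generator. -/
def genPar (g : Gen M) : ZMod 2 := (absDeg g : ZMod 2)

/-- The parity of a monomial. -/
def parity (m : Expo M) : ZMod 2 := ((degree m : ℤ) : ZMod 2)

theorem parity_zero : parity (0 : Expo M) = 0 := by simp [parity, degree]

theorem parity_add (a b : Expo M) : parity (a + b) = parity a + parity b := by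
  simp [parity, degree_add]

theorem parity_single (g : Gen M) : parity (Finsupp.single g 1) = genPar g := by
  rw [parity, degree_single, genPar]
  rcases h : ofLex g with i | i <;> simp [genDeg, absDeg, h]

theorem koszul_natCast (a b : ℕ) : koszul (a : ZMod 2) (b : ZMod 2) = (-1) ^ (a * b) := by
  rw [koszul]
  by_cases ha : Odd a
  · by_cases hb : Odd b
    · rw [if_pos ⟨(ZMod.natCast_eq_one_iff_odd).2 ha, (ZMod.natCast_eq_one_iff_odd).2 hb⟩,
        (ha.mul hb).neg_one_pow]
    · rw [if_neg fun h => hb ((ZMod.natCast_eq_one_iff_odd).1 h.2),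
        ((Nat.not_odd_iff_even.1 hb).mul_left a).neg_one_pow]
  · rw [if_neg fun h => ha ((ZMod.natCast_eq_one_iff_odd).1 h.1),
      ((Nat.not_odd_iff_even.1 ha).mul_right b).neg_one_pow]

theorem koszul_add_right (p q r : ZMod 2) : koszul p (q + r) = koszul p q * koszul p r := by
  revert p q r
  decide

theorem koszul_add_left (p q r : ZMod 2) : koszul (p + q) r = koszul p r * koszul q r := by
  revert p q r
  decide

theorem koszul_mul_self (p q : ZMod 2) : koszul p q * koszul p q = 1 := by
  revert p q
  decide

theorem koszul_comm (p q : ZMod 2) : koszul p q = koszul q p := by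
  revert p q
  decide

theorem koszul_zero_left (p : ZMod 2) : koszul 0 p = 1 := by
  revert p
  decide

theorem koszul_zero_right (p : ZMod 2) : koszul p 0 = 1 := by
  revert p
  decide

theorem sgn_mul_self (a b : Expo M) : sgn a b * sgn a b = 1 := by
  rw [sgn, ← mul_pow]
  norm_num

theorem sgn_zero_left (a : Expo M) : sgn 0 a = 1 := by simp [sgn]

theorem sgn_zero_right (a : Expo M) : sgn a 0 = 1 := by simp [sgn]

theorem sgn_add_left (a a' b : Expo M) : sgn (a + a') b = sgn a b * sgn a' b := by
  rw [sgn, sgn, sgn, ← pow_add, Finsupp.sum_add_index']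
  · intro g
    simp
  · intro g k k'
    rw [← Finsupp.sum_add]
    refine Finsupp.sum_congr fun h _ => ?_
    split_ifs
    · ring
    · rfl

theorem sgn_add_right (a b b' : Expo M) : sgn a (b + b') = sgn a b * sgn a b' := by
  rw [sgn, sgn, sgn, ← pow_add, ← Finsupp.sum_add]
  congr 1
  refine Finsupp.sum_congr fun g _ => ?_
  rw [Finsupp.sum_add_index']
  · intro h
    simp
  · intro h l l'
    split_ifs
    · ring
    · rfl

theorem sgn_single_single (g h : Gen M) (k l : ℕ) :
    sgn (Finsupp.single g k) (Finsupp.single h l) =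
      (-1) ^ (if h < g then k * l * (absDeg g * absDeg h) else 0) := by
  rw [sgn, Finsupp.sum_single_index (by simp), Finsupp.sum_single_index (by simp)]

/-- Moving a generator past a monomial. The factors equal to the generator are not counted
by `sgn`. -/
theorem sgn_single_mul_sgn (g : Gen M) (a : Expo M) :
    sgn (Finsupp.single g 1) a * sgn a (Finsupp.single g 1) =
      koszul (genPar g) (parity a) * (-1) ^ (absDeg g * a g) := by
  induction a using Finsupp.induction_linear with
  | zero => simp [sgn_zero_left, sgn_zero_right, parity_zero, koszul_zero_right]
  | add a b ha hb =>
    rw [sgn_add_left, sgn_add_right, parity_add, koszul_add_right, Finsupp.add_apply, mul_add,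
      pow_add]
    linear_combination (sgn (Finsupp.single g 1) b * sgn b (Finsupp.single g 1)) * ha +
      (koszul (genPar g) (parity a) * (-1) ^ (absDeg g * a g)) * hb
  | single h n =>
    have hp : parity (Finsupp.single h n) = ((n * absDeg h : ℕ) : ZMod 2) := by
      have h1 : Finsupp.single h n = n • (Finsupp.single h 1 : Expo M) := by simp
      have h2 : ∀ n : ℕ, parity (n • (Finsupp.single h 1 : Expo M)) = n * genPar h := by
        intro n
        induction n with
        | zero => simp [parity_zero]
        | succ n ih => rw [succ_nsmul, parity_add, ih, parity_single]; push_cast; ring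
      rw [h1, h2, genPar]
      push_cast
      rfl
    rw [sgn_single_single, sgn_single_single, hp, genPar, koszul_natCast, ← pow_add, ← pow_add]
    rcases lt_trichotomy g h with hgh | rfl | hgh
    · rw [if_neg hgh.asymm, if_pos hgh, Finsupp.single_eq_of_ne hgh.ne]
      congr 1
      ring
    · -- both sides are `1`, since `d * (d + 1)` is even
      rw [if_neg (lt_irrefl _), Finsupp.single_eq_same, Even.neg_one_pow, Even.neg_one_pow]
      · have : absDeg g * (n * absDeg g) + absDeg g * n = n * (absDeg g * (absDeg g + 1)) := by
          ring
        rw [this]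
        exact (Nat.even_mul_succ_self _).mul_left _
      · simp
    · rw [if_pos hgh, if_neg hgh.asymm, Finsupp.single_eq_of_ne hgh.ne']
      congr 1
      ring

theorem Allowed.of_le {a b : Expo M} (h : Allowed b) (hab : a ≤ b) : Allowed a :=
  fun g hg => (hab g).trans (h g hg)

/-- Monomials whose product does not vanish commute up to the Koszul sign. -/
theorem sgn_mul_sgn {a b : Expo M} (h : Allowed (a + b)) :
    sgn a b * sgn b a = koszul (parity a) (parity b) := by
  induction a using Finsupp.induction_linear with
  | zero => simp [sgn_zero_left, sgn_zero_right, parity_zero, koszul_zero_left]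
  | add a a' ha ha' =>
    have h1 := ha (h.of_le (add_le_add_left le_self_add b))
    have h2 := ha' (h.of_le (add_le_add_left le_add_self b))
    rw [sgn_add_left, sgn_add_right, parity_add, koszul_add_left, ← h1, ← h2]
    ring
  | single g n =>
    have key : ∀ n : ℕ, Allowed (Finsupp.single g n + b) →
        sgn (Finsupp.single g n) b * sgn b (Finsupp.single g n) =
          koszul (parity (Finsupp.single g n)) (parity b) := by
      intro n
      induction n with
      | zero => simp [sgn_zero_left, sgn_zero_right, parity_zero, koszul_zero_left]
      | succ n ih =>
        intro h
        have h1 := ih (h.of_le (add_le_add_left (Finsupp.single_mono (Nat.le_succ n)) b))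
        have h2 : (-1 : ℤ) ^ (absDeg g * b g) = 1 := by
          rcases Nat.even_or_odd (absDeg g) with he | ho
          · exact (he.mul_right _).neg_one_pow
          · have := h g ho
            rw [Finsupp.add_apply, Finsupp.single_eq_same] at this
            have hb : b g = 0 := by omega
            rw [hb, mul_zero, pow_zero]
        have h3 := sgn_single_mul_sgn g b
        rw [h2, mul_one] at h3
        rw [Finsupp.single_add, sgn_add_left, sgn_add_right, parity_add, koszul_add_left, ← h1,
          parity_single, ← h3]
        ring
    exact key n h

/-! ### Sums over decompositions of a monomial -/

theorem sum_antidiagonal_swap {R : Type*} [AddCommMonoid R] (m : Expo M)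
    (f : Expo M × Expo M → R) :
    ∑ ab ∈ Finset.HasAntidiagonal.antidiagonal m, f ab.swap =
      ∑ ab ∈ Finset.HasAntidiagonal.antidiagonal m, f ab :=
  Finset.sum_equiv (Equiv.prodComm _ _)
    (by simp [Finset.HasAntidiagonal.mem_antidiagonal, add_comm]) fun _ _ => rfl

theorem sum_antidiagonal_add_right {R : Type*} [AddCommMonoid R] (n α : Expo M)
    (f : Expo M × Expo M → R) (hf : ∀ a b, a + b = n + α → ¬ α ≤ b → f (a, b) = 0) :
    ∑ ab ∈ Finset.HasAntidiagonal.antidiagonal (n + α), f ab =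
      ∑ ab ∈ Finset.HasAntidiagonal.antidiagonal n, f (ab.1, ab.2 + α) := by
  symm
  refine Finset.sum_of_injOn (fun ab => (ab.1, ab.2 + α)) ?_ ?_ ?_ fun _ _ => rfl
  · rintro ⟨a, b⟩ - ⟨a', b'⟩ - h
    simpa using h
  · rintro ⟨a, b⟩ h
    simp only [Finset.mem_coe, Finset.HasAntidiagonal.mem_antidiagonal] at h ⊢
    rw [← h, add_assoc]
  · rintro ⟨a, b⟩ h h'
    rw [Finset.HasAntidiagonal.mem_antidiagonal] at h
    refine hf a b h fun hb => h' ⟨(a, b - α), ?_, ?_⟩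
    · simp only [Finset.mem_coe, Finset.HasAntidiagonal.mem_antidiagonal]
      simp only at h
      rw [← tsub_add_cancel_of_le hb, ← add_assoc] at h
      exact add_right_cancel h
    · simp only [tsub_add_cancel_of_le hb]

theorem sum_antidiagonal_add_left {R : Type*} [AddCommMonoid R] (n α : Expo M)
    (f : Expo M × Expo M → R) (hf : ∀ a b, a + b = n + α → ¬ α ≤ a → f (a, b) = 0) :
    ∑ ab ∈ Finset.HasAntidiagonal.antidiagonal (n + α), f ab =
      ∑ ab ∈ Finset.HasAntidiagonal.antidiagonal n, f (ab.1 + α, ab.2) := by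
  rw [← sum_antidiagonal_swap, sum_antidiagonal_add_right n α,
    ← sum_antidiagonal_swap]
  · rfl
  · intro a b h h'
    exact hf b a (by rw [add_comm, h]) h'

end BFV

namespace BFV
variable {M : GhostBasis}

theorem sum_antidiagonal_assoc {R : Type*} [AddCommMonoid R] (m : Expo M)
    (f : Expo M → Expo M → Expo M → R) :
    ∑ u ∈ Finset.HasAntidiagonal.antidiagonal m,
        ∑ v ∈ Finset.HasAntidiagonal.antidiagonal u.2, f u.1 v.1 v.2 =
      ∑ u ∈ Finset.HasAntidiagonal.antidiagonal m,
        ∑ v ∈ Finset.HasAntidiagonal.antidiagonal u.1, f v.1 v.2 u.2 := by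
  rw [Finset.sum_sigma', Finset.sum_sigma']
  refine Finset.sum_nbij' (fun s => ⟨(s.1.1 + s.2.1, s.2.2), (s.1.1, s.2.1)⟩)
    (fun s => ⟨(s.2.1, s.2.2 + s.1.2), (s.2.2, s.1.2)⟩) ?_ ?_ ?_ ?_ fun _ _ => rfl
  all_goals
    rintro ⟨⟨a, b⟩, ⟨c, d⟩⟩ h
    simp only [Finset.mem_sigma, Finset.HasAntidiagonal.mem_antidiagonal] at h ⊢
    obtain ⟨rfl, rfl⟩ := h
    simp [add_assoc]

/-! ### Twisted convolution -/

variable {𝕜 P : Type*} [CommRing 𝕜] [CommRing P] [Algebra 𝕜 P]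

theorem series_ext {P : Type*} {x y : Series M P} (h : ∀ m, x m = y m) : x = y := funext h

theorem neg_app (x : Series M P) (m : Expo M) : (-x) m = -x m := rfl

theorem zsmul_app (n : ℤ) (x : Series M P) (m : Expo M) : (n • x) m = n • x m := rfl

theorem sum_app {K : Type*} (s : Finset K) (f : K → Series M P) (m : Expo M) :
    (∑ k ∈ s, f k) m = ∑ k ∈ s, f k m :=
  Finset.sum_apply (M := fun _ : Expo M => P) m s f

/-- The extension of a bilinear operation on coefficients to series, with the Koszul signs of
the product of monomials. -/
noncomputable def conv (β : P →ₗ[𝕜] P →ₗ[𝕜] P) (x y : Series M P) : Series M P := fun m =>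
  if Allowed m then
    ∑ ab ∈ Finset.HasAntidiagonal.antidiagonal m, sgn ab.1 ab.2 • β (x ab.1) (y ab.2) else 0

theorem conv_app {β : P →ₗ[𝕜] P →ₗ[𝕜] P} {m : Expo M} (hm : Allowed m) (x y : Series M P) :
    conv β x y m =
      ∑ ab ∈ Finset.HasAntidiagonal.antidiagonal m, sgn ab.1 ab.2 • β (x ab.1) (y ab.2) :=
  if_pos hm

theorem conv_app_of_not {β : P →ₗ[𝕜] P →ₗ[𝕜] P} {m : Expo M} (hm : ¬ Allowed m)
    (x y : Series M P) : conv β x y m = 0 :=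
  if_neg hm

variable (𝕜) in
theorem mul_eq_conv (x y : Series M P) : x * y = conv (LinearMap.mul 𝕜 P) x y := by
  funext m
  change (if Allowed m then _ else _) = (if Allowed m then _ else _)
  simp only [LinearMap.mul_apply', zsmul_eq_mul]

theorem bracketP_eq_conv {𝕜 : Type*} [Field 𝕜] [Algebra 𝕜 P] [PoissonAlgebra 𝕜 P]
    (x y : Series M P) : bracketP 𝕜 x y = conv (PoissonAlgebra.bracket (𝕜 := 𝕜)) x y := by
  funext m
  simp only [bracketP, conv, zsmul_eq_mul, pbr]

theorem conv_add_right (β : P →ₗ[𝕜] P →ₗ[𝕜] P) (x y z : Series M P) :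
    conv β x (y + z) = conv β x y + conv β x z := by
  refine series_ext fun m => ?_
  rw [add_app]
  by_cases hm : Allowed m
  · rw [conv_app hm, conv_app hm, conv_app hm, ← Finset.sum_add_distrib]
    exact Finset.sum_congr rfl fun ab _ => by rw [add_app, map_add, smul_add]
  · rw [conv_app_of_not hm, conv_app_of_not hm, conv_app_of_not hm, add_zero]

theorem conv_add_left (β : P →ₗ[𝕜] P →ₗ[𝕜] P) (x y z : Series M P) :
    conv β (x + y) z = conv β x z + conv β y z := by
  refine series_ext fun m => ?_
  rw [add_app]
  by_cases hm : Allowed m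
  · rw [conv_app hm, conv_app hm, conv_app hm, ← Finset.sum_add_distrib]
    exact Finset.sum_congr rfl fun ab _ => by
      rw [add_app, map_add, LinearMap.add_apply, smul_add]
  · rw [conv_app_of_not hm, conv_app_of_not hm, conv_app_of_not hm, add_zero]

/-- `conv` as a biadditive map. -/
noncomputable def convHom (β : P →ₗ[𝕜] P →ₗ[𝕜] P) : Series M P →+ Series M P →+ Series M P :=
  AddMonoidHom.mk' (fun x => AddMonoidHom.mk' (conv β x) (conv_add_right β x))
    fun x y => AddMonoidHom.ext fun z => conv_add_left β x y z

theorem convHom_apply (β : P →ₗ[𝕜] P →ₗ[𝕜] P) (x y : Series M P) :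
    convHom β x y = conv β x y := rfl

/-- The trilinear analogue of `conv`. -/
noncomputable def triConv (γ : P → P → P → P) (x y z : Series M P) : Series M P := fun m =>
  if Allowed m then
    ∑ u ∈ Finset.HasAntidiagonal.antidiagonal m,
      ∑ v ∈ Finset.HasAntidiagonal.antidiagonal u.1,
        (sgn v.1 v.2 * sgn v.1 u.2 * sgn v.2 u.2) • γ (x v.1) (y v.2) (z u.2) else 0

theorem triConv_app {γ : P → P → P → P} {m : Expo M} (hm : Allowed m) (x y z : Series M P) :
    triConv γ x y z m = ∑ u ∈ Finset.HasAntidiagonal.antidiagonal m,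
      ∑ v ∈ Finset.HasAntidiagonal.antidiagonal u.1,
        (sgn v.1 v.2 * sgn v.1 u.2 * sgn v.2 u.2) • γ (x v.1) (y v.2) (z u.2) :=
  if_pos hm

theorem triConv_app_of_not {γ : P → P → P → P} {m : Expo M} (hm : ¬ Allowed m)
    (x y z : Series M P) : triConv γ x y z m = 0 :=
  if_neg hm

theorem conv_conv_left (β₁ β₂ : P →ₗ[𝕜] P →ₗ[𝕜] P) (x y z : Series M P) :
    conv β₁ (conv β₂ x y) z = triConv (fun a b c => β₁ (β₂ a b) c) x y z := by
  refine series_ext fun m => ?_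
  by_cases hm : Allowed m
  · rw [conv_app hm, triConv_app hm]
    refine Finset.sum_congr rfl fun u hu => ?_
    rw [Finset.HasAntidiagonal.mem_antidiagonal] at hu
    rw [conv_app (hm.of_le (hu ▸ le_self_add)), map_sum, LinearMap.sum_apply, Finset.smul_sum]
    refine Finset.sum_congr rfl fun v hv => ?_
    rw [Finset.HasAntidiagonal.mem_antidiagonal] at hv
    rw [map_zsmul, LinearMap.smul_apply, smul_smul, ← hv, sgn_add_left]
    congr 1
    ring
  · rw [conv_app_of_not hm, triConv_app_of_not hm]

theorem conv_conv_right (β₁ β₂ : P →ₗ[𝕜] P →ₗ[𝕜] P) (x y z : Series M P) :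
    conv β₁ x (conv β₂ y z) = triConv (fun a b c => β₁ a (β₂ b c)) x y z := by
  refine series_ext fun m => ?_
  by_cases hm : Allowed m
  · rw [conv_app hm, triConv_app hm, ← sum_antidiagonal_assoc m fun a b c =>
      (sgn a b * sgn a c * sgn b c) • β₁ (x a) (β₂ (y b) (z c))]
    refine Finset.sum_congr rfl fun u hu => ?_
    rw [Finset.HasAntidiagonal.mem_antidiagonal] at hu
    rw [conv_app (hm.of_le (hu ▸ le_add_self)), map_sum, Finset.smul_sum]
    refine Finset.sum_congr rfl fun v hv => ?_
    rw [Finset.HasAntidiagonal.mem_antidiagonal] at hv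
    rw [map_zsmul, smul_smul, ← hv, sgn_add_right]
  · rw [conv_app_of_not hm, triConv_app_of_not hm]

theorem triConv_add (γ γ' : P → P → P → P) (x y z : Series M P) :
    triConv (fun a b c => γ a b c + γ' a b c) x y z = triConv γ x y z + triConv γ' x y z := by
  refine series_ext fun m => ?_
  rw [add_app]
  by_cases hm : Allowed m
  · rw [triConv_app hm, triConv_app hm, triConv_app hm]
    simp only [smul_add, Finset.sum_add_distrib]
  · rw [triConv_app_of_not hm, triConv_app_of_not hm, triConv_app_of_not hm, add_zero]

noncomputable instance : NonUnitalRing (Series M P) where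
  left_distrib x y z := by simp only [mul_eq_conv ℤ, conv_add_right]
  right_distrib x y z := by simp only [mul_eq_conv ℤ, conv_add_left]
  zero_mul x := by rw [mul_eq_conv ℤ, ← convHom_apply, map_zero, AddMonoidHom.zero_apply]
  mul_zero x := by rw [mul_eq_conv ℤ, ← convHom_apply, map_zero]
  mul_assoc x y z := by
    simp only [mul_eq_conv ℤ, conv_conv_left, conv_conv_right, LinearMap.mul_apply', mul_assoc]

/-! ### Parity -/

variable (M P) in
/-- The series of parity `p`. -/
def parPart (p : ZMod 2) : AddSubgroup (Series M P) where
  carrier := {x | ∀ m, x m ≠ 0 → Allowed m ∧ parity m = p}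
  add_mem' := by
    intro x y hx hy m hm
    by_cases h : x m = 0
    · exact hy m fun h' => hm (by rw [add_app, h, h', add_zero])
    · exact hx m h
  zero_mem' := fun m hm => absurd rfl hm
  neg_mem' := by
    intro x hx m hm
    exact hx m fun h => hm (by rw [neg_app, h, neg_zero])

theorem comp_le_parPart {𝕜 : Type*} [Field 𝕜] [Algebra 𝕜 P] {j : ℤ} {x : Series M P}
    (hx : x ∈ comp M P 𝕜 j) : x ∈ parPart M P (j : ZMod 2) := by
  intro m hm
  exact ⟨(hx m hm).1, by rw [parity, (hx m hm).2]⟩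

theorem conv_app_ne {β : P →ₗ[𝕜] P →ₗ[𝕜] P} {x y : Series M P} {m : Expo M}
    (h : conv β x y m ≠ 0) : Allowed m ∧ ∃ a b, a + b = m ∧ x a ≠ 0 ∧ y b ≠ 0 := by
  by_cases hm : Allowed m
  · refine ⟨hm, ?_⟩
    by_contra! hc
    refine h ?_
    rw [conv_app hm]
    refine Finset.sum_eq_zero fun ab hab => ?_
    rw [Finset.HasAntidiagonal.mem_antidiagonal] at hab
    by_cases hx : x ab.1 = 0
    · rw [hx, map_zero, LinearMap.zero_apply, smul_zero]
    · rw [hc _ _ hab hx, map_zero, smul_zero]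
  · exact absurd (conv_app_of_not hm x y) h

variable {p q r : ZMod 2} {x y z : Series M P}

theorem conv_mem_parPart (β : P →ₗ[𝕜] P →ₗ[𝕜] P) (hx : x ∈ parPart M P p)
    (hy : y ∈ parPart M P q) : conv β x y ∈ parPart M P (p + q) := by
  intro m hm
  obtain ⟨h, a, b, rfl, ha, hb⟩ := conv_app_ne hm
  exact ⟨h, by rw [parity_add, (hx a ha).2, (hy b hb).2]⟩

/-- For series of given parity, exchanging the arguments costs a Koszul sign. -/
theorem conv_flip (β : P →ₗ[𝕜] P →ₗ[𝕜] P) (hx : x ∈ parPart M P p)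
    (hy : y ∈ parPart M P q) : conv β x y = koszul p q • conv β.flip y x := by
  refine series_ext fun m => ?_
  rw [zsmul_app]
  by_cases hm : Allowed m
  · rw [conv_app hm, conv_app hm, Finset.smul_sum, ← sum_antidiagonal_swap]
    refine Finset.sum_congr rfl fun ab hab => ?_
    rw [Finset.HasAntidiagonal.mem_antidiagonal, add_comm] at hab
    rw [LinearMap.flip_apply, smul_smul]
    simp only [Prod.fst_swap, Prod.snd_swap]
    by_cases ha : x ab.2 = 0
    · rw [ha, map_zero, LinearMap.zero_apply, smul_zero, smul_zero]
    by_cases hb : y ab.1 = 0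
    · rw [hb, map_zero, smul_zero, smul_zero]
    congr 1
    rw [← (hx _ ha).2, ← (hy _ hb).2, ← sgn_mul_sgn (hab ▸ hm), mul_assoc, sgn_mul_self, mul_one]
  · rw [conv_app_of_not hm, conv_app_of_not hm, smul_zero]

theorem triConv_swap (γ : P → P → P → P) (h₁ : ∀ b c, γ 0 b c = 0) (h₂ : ∀ a c, γ a 0 c = 0)
    (hx : x ∈ parPart M P p) (hy : y ∈ parPart M P q) :
    triConv γ x y z = koszul p q • triConv (fun b a c => γ a b c) y x z := by
  refine series_ext fun m => ?_
  rw [zsmul_app]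
  by_cases hm : Allowed m
  · rw [triConv_app hm, triConv_app hm, Finset.smul_sum]
    refine Finset.sum_congr rfl fun u hu => ?_
    rw [Finset.HasAntidiagonal.mem_antidiagonal] at hu
    rw [Finset.smul_sum, ← sum_antidiagonal_swap]
    refine Finset.sum_congr rfl fun v hv => ?_
    rw [Finset.HasAntidiagonal.mem_antidiagonal, add_comm] at hv
    rw [smul_smul]
    simp only [Prod.fst_swap, Prod.snd_swap]
    by_cases ha : x v.2 = 0
    · rw [ha, h₁, smul_zero, smul_zero]
    by_cases hb : y v.1 = 0
    · rw [hb, h₂, smul_zero, smul_zero]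
    congr 1
    have hs := sgn_mul_sgn (a := v.2) (b := v.1)
      (hm.of_le (hv ▸ hu ▸ (le_self_add : u.1 ≤ u.1 + u.2)))
    rw [(hx _ ha).2, (hy _ hb).2] at hs
    rw [← hs]
    linear_combination -(sgn v.2 v.1 * sgn v.2 u.2 * sgn v.1 u.2) * sgn_mul_self v.1 v.2
  · rw [triConv_app_of_not hm, triConv_app_of_not hm, smul_zero]

theorem mul_mem_parPart (hx : x ∈ parPart M P p) (hy : y ∈ parPart M P q) :
    x * y ∈ parPart M P (p + q) := by
  rw [mul_eq_conv ℤ]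
  exact conv_mem_parPart _ hx hy

theorem mul_graded_comm (hx : x ∈ parPart M P p) (hy : y ∈ parPart M P q) :
    x * y = koszul p q • (y * x) := by
  rw [mul_eq_conv ℤ, mul_eq_conv ℤ, conv_flip _ hx hy]
  congr 2
  ext
  simp

/-! ### The bracket of the coefficients -/

section Poisson

variable {𝕜 : Type*} [Field 𝕜] [Algebra 𝕜 P] [PoissonAlgebra 𝕜 P]

theorem bracketP_skew (hx : x ∈ parPart M P p) (hy : y ∈ parPart M P q) :
    bracketP 𝕜 x y = -koszul p q • bracketP 𝕜 y x := by
  have h : (PoissonAlgebra.bracket (𝕜 := 𝕜) (A := P)).flip = -PoissonAlgebra.bracket := by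
    ext a b
    exact Reduction.pbr_skew 𝕜 b a
  rw [bracketP_eq_conv, bracketP_eq_conv, conv_flip _ hx hy, h, neg_smul, ← smul_neg]
  congr 1
  refine series_ext fun m => ?_
  rw [neg_app]
  simp only [conv, LinearMap.neg_apply, smul_neg, Finset.sum_neg_distrib, neg_ite, neg_zero]

theorem bracketP_leibniz (hx : x ∈ parPart M P p) (hy : y ∈ parPart M P q) :
    bracketP 𝕜 x (y * z) = bracketP 𝕜 x y * z + koszul p q • (y * bracketP 𝕜 x z) := by
  simp only [bracketP_eq_conv, mul_eq_conv 𝕜, conv_conv_left, conv_conv_right]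
  rw [triConv_swap _ (by simp) (by simp) hy hx, smul_smul, koszul_comm q p, koszul_mul_self,
    one_smul, ← triConv_add]
  congr 1
  funext a b c
  exact PoissonAlgebra.leibniz a b c

theorem bracketP_jacobi (hx : x ∈ parPart M P p) (hy : y ∈ parPart M P q) :
    bracketP 𝕜 x (bracketP 𝕜 y z) =
      bracketP 𝕜 (bracketP 𝕜 x y) z + koszul p q • bracketP 𝕜 y (bracketP 𝕜 x z) := by
  simp only [bracketP_eq_conv, conv_conv_left, conv_conv_right]
  rw [triConv_swap (fun a b c => PoissonAlgebra.bracket (𝕜 := 𝕜) a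
    (PoissonAlgebra.bracket (𝕜 := 𝕜) b c)) (by simp) (by simp) hy hx, smul_smul, koszul_comm q p,
    koszul_mul_self, one_smul, ← triConv_add]
  congr 1
  funext a b c
  exact PoissonAlgebra.jacobi a b c

end Poisson

end BFV

namespace BFV
variable {M : GhostBasis} {𝕜 P : Type*} [CommRing 𝕜] [CommRing P] [Algebra 𝕜 P]
variable {p q r : ZMod 2} {x y z : Series M P}

/-! ### Derivatives -/

/-- The coefficient of `z ^ (k - 1)` in the derivative of `z ^ k`, for a variable `z` of degree
`d`. If `d` is odd, this is the number `1 - 1 + 1 - ⋯` with `k` terms. -/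
def qNat (d k : ℕ) : ℤ := if Odd d then (if Odd k then 1 else 0) else k

theorem qNat_add (d a b : ℕ) : qNat d (a + b) = qNat d a + (-1) ^ (d * a) * qNat d b := by
  by_cases hd : Odd d
  · simp only [qNat, if_pos hd]
    by_cases ha : Odd a
    · rw [(hd.mul ha).neg_one_pow]
      by_cases hb : Odd b
      · simp [ha, hb, Nat.odd_add]
      · simp [ha, hb, Nat.odd_add]
    · rw [((Nat.not_odd_iff_even.1 ha).mul_left d).neg_one_pow]
      by_cases hb : Odd b
      · simp [ha, hb, Nat.odd_add]
      · simp [ha, hb, Nat.odd_add]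
  · simp [qNat, if_neg hd, ((Nat.not_odd_iff_even.1 hd).mul_right a).neg_one_pow]

theorem qNat_zero (d : ℕ) : qNat d 0 = 0 := by simp [qNat]

theorem qNat_of_le {d k : ℕ} (h : Odd d → k ≤ 1) : qNat d k = k := by
  by_cases hd : Odd d
  · have := h hd
    interval_cases k <;> simp [qNat]
  · simp [qNat, hd]

theorem leftD_app (hx : x ∈ parPart M P p) (g : Gen M) (m : Expo M) :
    leftD g x m = (qNat (absDeg g) (m g + 1) * sgn (Finsupp.single g 1) m) •
      x (m + Finsupp.single g 1) := by
  by_cases h : x (m + Finsupp.single g 1) = 0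
  · rw [leftD, h, mul_zero, mul_zero, smul_zero]
  · have h1 := (hx _ h).1 g
    rw [Finsupp.add_apply, Finsupp.single_eq_same] at h1
    rw [qNat_of_le h1, leftD, zsmul_eq_mul]
    push_cast
    ring

theorem leftD_mem_parPart (g : Gen M) (hx : x ∈ parPart M P p) :
    leftD g x ∈ parPart M P (p + genPar g) := by
  intro m hm
  obtain ⟨h1, h2⟩ := hx _ (leftD_app_ne hm)
  refine ⟨h1.of_le le_self_add, ?_⟩
  rw [← h2, parity_add, parity_single, add_assoc, CharTwo.add_self_eq_zero, add_zero]

/-- Left and right derivatives agree up to sign. -/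
theorem rightD_eq (g : Gen M) (hx : x ∈ parPart M P p) :
    rightD g x = koszul (genPar g) (p + genPar g) • leftD g x := by
  refine series_ext fun m => ?_
  rw [zsmul_app]
  by_cases h : x (m + Finsupp.single g 1) = 0
  · rw [leftD, rightD, h]
    simp
  · obtain ⟨h1, h2⟩ := hx _ h
    have h3 := sgn_mul_sgn h1
    rw [parity_add, parity_single] at h2
    rw [parity_single, show parity m = p + genPar g by
      rw [← h2, add_assoc, CharTwo.add_self_eq_zero, add_zero], koszul_comm] at h3
    have h4 : sgn m (Finsupp.single g 1) = koszul (genPar g) (p + genPar g) *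
        sgn (Finsupp.single g 1) m := by
      rw [← h3, mul_assoc, sgn_mul_self, mul_one]
    rw [leftD, rightD, h4, zsmul_eq_mul]
    push_cast
    ring

/-- The left derivatives commute up to the Koszul sign. -/
theorem leftD_comm (g h : Gen M) (hx : x ∈ parPart M P p) :
    leftD g (leftD h x) = koszul (genPar g) (genPar h) • leftD h (leftD g x) := by
  refine series_ext fun m => ?_
  rw [zsmul_app, leftD_app (leftD_mem_parPart h hx), leftD_app (leftD_mem_parPart g hx),
    leftD_app hx, leftD_app hx, add_right_comm, smul_smul, smul_smul, smul_smul]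
  rcases eq_or_ne g h with rfl | hgh
  · by_cases hg : Odd (absDeg g)
    · have : x (m + Finsupp.single g 1 + Finsupp.single g 1) = 0 := by
        by_contra h
        have := (hx _ h).1 g hg
        simp at this
      rw [this, smul_zero, smul_zero]
    · rw [genPar, koszul_natCast, ((Nat.not_odd_iff_even.1 hg).mul_right _).neg_one_pow, one_mul]
  · congr 1
    have h1 : sgn (Finsupp.single h 1) (Finsupp.single g 1) = koszul (genPar g) (genPar h) *
        sgn (Finsupp.single g 1) (Finsupp.single h 1) := by
      have h2 := sgn_single_mul_sgn g (Finsupp.single h 1)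
      rw [Finsupp.single_eq_of_ne hgh, mul_zero, pow_zero, mul_one, parity_single] at h2
      rw [← h2, mul_right_comm, sgn_mul_self, one_mul]
    rw [sgn_add_right, sgn_add_right, Finsupp.add_apply, Finsupp.add_apply,
      Finsupp.single_eq_of_ne hgh, Finsupp.single_eq_of_ne hgh.symm, h1]
    simp only [add_zero]
    ring

/-- The derivatives are graded derivations of every bilinear operation on coefficients. -/
theorem leftD_conv (β : P →ₗ[𝕜] P →ₗ[𝕜] P) (g : Gen M) (hx : x ∈ parPart M P p)
    (hy : y ∈ parPart M P q) :
    leftD g (conv β x y) =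
      conv β (leftD g x) y + koszul (genPar g) p • conv β x (leftD g y) := by
  refine series_ext fun m => ?_
  rw [add_app, zsmul_app, leftD_app (conv_mem_parPart β hx hy)]
  by_cases hm : Allowed m
  swap
  · rw [conv_app_of_not fun h => hm (h.of_le le_self_add), conv_app_of_not hm,
      conv_app_of_not hm, smul_zero, smul_zero, add_zero]
  -- the truncation to allowed monomials does not matter, since `qNat d 2 = 0` for odd `d`
  have h1 : (qNat (absDeg g) (m g + 1) * sgn (Finsupp.single g 1) m) •
      conv β x y (m + Finsupp.single g 1) =
      (qNat (absDeg g) (m g + 1) * sgn (Finsupp.single g 1) m) •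
        ∑ ab ∈ Finset.HasAntidiagonal.antidiagonal (m + Finsupp.single g 1),
          sgn ab.1 ab.2 • β (x ab.1) (y ab.2) := by
    by_cases h : Allowed (m + Finsupp.single g 1)
    · rw [conv_app h]
    · have h0 : qNat (absDeg g) (m g + 1) = 0 := by
        by_contra h0
        refine h fun g' hg' => ?_
        rcases eq_or_ne g' g with rfl | hne
        · rw [qNat, if_pos hg'] at h0
          have := hm g' hg'
          rw [Finsupp.add_apply, Finsupp.single_eq_same]
          by_contra h3
          have h4 : m g' + 1 = 2 := by omega
          rw [h4] at h0
          exact h0 (if_neg (by decide))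
        · rw [Finsupp.add_apply, Finsupp.single_eq_of_ne hne, add_zero]
          exact hm g' hg'
      rw [h0, zero_mul, zero_smul, zero_smul]
  rw [h1, Finset.smul_sum, conv_app hm, conv_app hm, Finset.smul_sum]
  have h2 : ∀ ab ∈ Finset.HasAntidiagonal.antidiagonal (m + Finsupp.single g 1),
      (qNat (absDeg g) (m g + 1) * sgn (Finsupp.single g 1) m) •
        sgn ab.1 ab.2 • β (x ab.1) (y ab.2) =
      (qNat (absDeg g) (ab.1 g) * sgn (Finsupp.single g 1) m * sgn ab.1 ab.2) •
        β (x ab.1) (y ab.2) +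
      ((-1) ^ (absDeg g * ab.1 g) * qNat (absDeg g) (ab.2 g) * sgn (Finsupp.single g 1) m *
        sgn ab.1 ab.2) • β (x ab.1) (y ab.2) := by
    intro ab hab
    rw [Finset.HasAntidiagonal.mem_antidiagonal] at hab
    have h3 : m g + 1 = ab.1 g + ab.2 g := by
      have := DFunLike.congr_fun hab g
      rw [Finsupp.add_apply, Finsupp.add_apply, Finsupp.single_eq_same] at this
      exact this.symm
    rw [h3, qNat_add, smul_smul, ← add_smul]
    congr 1
    ring
  rw [Finset.sum_congr rfl h2, Finset.sum_add_distrib]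
  congr 1
  · rw [sum_antidiagonal_add_left]
    · refine Finset.sum_congr rfl fun ab hab => ?_
      rw [Finset.HasAntidiagonal.mem_antidiagonal] at hab
      rw [leftD_app hx, map_zsmul, LinearMap.smul_apply, smul_smul, Finsupp.add_apply,
        Finsupp.single_eq_same, ← hab, sgn_add_right, sgn_add_left]
      congr 1
      linear_combination (qNat (absDeg g) (ab.1 g + 1) * sgn (Finsupp.single g 1) ab.1 *
        sgn ab.1 ab.2) * sgn_mul_self (Finsupp.single g 1) ab.2
    · intro a b _ h
      have h0 : a g = 0 := by
        by_contra h0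
        exact h (Finsupp.single_le_iff.2 (Nat.one_le_iff_ne_zero.2 h0))
      rw [h0, qNat_zero, zero_mul, zero_mul, zero_smul]
  · rw [sum_antidiagonal_add_right]
    · refine Finset.sum_congr rfl fun ab hab => ?_
      rw [Finset.HasAntidiagonal.mem_antidiagonal] at hab
      by_cases hx0 : x ab.1 = 0
      · simp only [hx0, map_zero, LinearMap.zero_apply, smul_zero]
      rw [leftD_app hy, map_zsmul, smul_smul, smul_smul, Finsupp.add_apply,
        Finsupp.single_eq_same, ← hab, sgn_add_right, sgn_add_right, ← (hx _ hx0).2]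
      congr 1
      have h3 := sgn_single_mul_sgn g ab.1
      have h4 : (-1 : ℤ) ^ (absDeg g * ab.1 g) * (-1) ^ (absDeg g * ab.1 g) = 1 := by
        rw [← mul_pow]
        norm_num
      linear_combination ((-1) ^ (absDeg g * ab.1 g) * qNat (absDeg g) (ab.2 g + 1) *
        sgn (Finsupp.single g 1) ab.2 * sgn ab.1 ab.2) * h3 +
        (koszul (genPar g) (parity ab.1) * qNat (absDeg g) (ab.2 g + 1) *
        sgn (Finsupp.single g 1) ab.2 * sgn ab.1 ab.2) * h4
    · intro a b _ h
      have h0 : b g = 0 := by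
        by_contra h0
        exact h (Finsupp.single_le_iff.2 (Nat.one_le_iff_ne_zero.2 h0))
      rw [h0, qNat_zero, mul_zero, zero_mul, zero_mul, zero_smul]

theorem leftD_mul (g : Gen M) (hx : x ∈ parPart M P p) (hy : y ∈ parPart M P q) :
    leftD g (x * y) = leftD g x * y + koszul (genPar g) p • (x * leftD g y) := by
  simp only [mul_eq_conv ℤ]
  exact leftD_conv _ g hx hy

/-! ### The bracket with finitely many pairs of generators -/

section Bracket

variable {𝕜 P : Type*} [Field 𝕜] [CommRing P] [Algebra 𝕜 P] [PoissonAlgebra 𝕜 P]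
variable {p q r : ZMod 2} {x y z : Series M P}

/-- The pairs `e i`, `e* i` with `i ∈ s`. -/
def pairGen (s : Finset M.ι) (k : s × Bool) : Gen M := if k.2 then es k.1.1 else ee k.1.1

theorem genPar_ee (i : M.ι) : genPar (ee i) = (M.deg i : ZMod 2) := rfl

theorem genPar_es (i : M.ι) : genPar (es i) = (M.deg i : ZMod 2) := rfl

theorem genPar_pairGen (s : Finset M.ι) (k : s × Bool) :
    genPar (pairGen s k) = (M.deg k.1.1 : ZMod 2) := by
  rcases k with ⟨i, _ | _⟩ <;> rfl

variable (M 𝕜 P) in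
/-- The series, the bracket of their coefficients, and the derivatives by `e i` and `e* i` for
`i` in a finite set `s`. -/
noncomputable def hamiltonianData (s : Finset M.ι) : HamiltonianData (Series M P) (s × Bool) where
  𝒜 := parPart M P
  mul_mem := mul_mem_parPart
  mul_comm := mul_graded_comm
  dual := Equiv.prodCongr (Equiv.refl _) Equiv.boolNot
  dual_dual := by
    rintro ⟨i, _ | _⟩ <;> rfl
  par k := M.deg k.1.1
  par_dual k := rfl
  ω k := if k.2 then -koszul (M.deg k.1.1) (M.deg k.1.1) else 1
  ω_dual := by
    rintro ⟨i, _ | _⟩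
    · simp
    · simp [koszul_mul_self]
  D k := AddMonoidHom.mk' (leftD (pairGen s k)) (leftD_add _)
  D_mem k hx := by
    rw [← genPar_pairGen]
    exact leftD_mem_parPart _ hx
  D_mul k hx hy := by
    rw [← genPar_pairGen]
    exact leftD_mul _ hx hy
  D_comm k l hx := by
    rw [← genPar_pairGen, ← genPar_pairGen]
    exact leftD_comm _ _ hx
  B := convHom (PoissonAlgebra.bracket (𝕜 := 𝕜))
  B_mem := conv_mem_parPart _
  B_skew hx hy := by
    simp only [convHom_apply, ← bracketP_eq_conv]
    exact bracketP_skew hx hy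
  B_leibniz hx hy _ := by
    simp only [convHom_apply, ← bracketP_eq_conv]
    exact bracketP_leibniz hx hy
  B_jacobi hx hy _ := by
    simp only [convHom_apply, ← bracketP_eq_conv]
    exact bracketP_jacobi hx hy
  D_B k hx hy := by
    rw [← genPar_pairGen]
    exact leftD_conv _ _ hx hy

variable (𝕜) in
/-- The bracket on `X` in which only the pairs `e i`, `e* i` with `i ∈ s` occur. -/
noncomputable def bracketOn (s : Finset M.ι) (x y : Series M P) : Series M P := fun m =>
  bracketP 𝕜 x y m + ∑ i ∈ s, term x y m i

theorem bracketOn_eq_br (s : Finset M.ι) (hx : x ∈ parPart M P p) :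
    bracketOn 𝕜 s x y = (hamiltonianData M 𝕜 P s).br p x y := by
  refine series_ext fun m => ?_
  rw [HamiltonianData.br, add_app, bracketOn]
  congr 1
  · rw [bracketP_eq_conv]
    rfl
  · rw [HamiltonianData.symp, Fintype.sum_prod_type, sum_app, ← Finset.sum_coe_sort]
    refine Finset.sum_congr rfl fun i _ => ?_
    have h1 : (-1 : P) ^ M.deg i.1 = ((koszul (M.deg i.1) (M.deg i.1) : ℤ) : P) := by
      rw [koszul_natCast]
      push_cast
      rcases Nat.even_or_odd (M.deg i.1) with h | h
      · rw [h.neg_one_pow, (h.mul_left _).neg_one_pow]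
      · rw [h.neg_one_pow, (h.mul h).neg_one_pow]
    have h2 : (hamiltonianData M 𝕜 P s).coef (i, false) p =
        koszul (M.deg i.1) (p + M.deg i.1) * 1 := rfl
    have h3 : (hamiltonianData M 𝕜 P s).coef (i, true) p =
        koszul (M.deg i.1) (p + M.deg i.1) * -koszul (M.deg i.1) (M.deg i.1) := rfl
    rw [Fintype.sum_bool, h2, h3, add_app, zsmul_app, zsmul_app, term, rightD_eq _ hx,
      rightD_eq _ hx, smul_mul_assoc, smul_mul_assoc, zsmul_app, zsmul_app, genPar_ee, genPar_es,
      h1]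
    change _ = (_ * -_) • (leftD (es i.1) x * leftD (ee i.1) y) m +
      (_ * 1) • (leftD (ee i.1) x * leftD (es i.1) y) m
    simp only [zsmul_eq_mul]
    push_cast
    ring

/-- The graded Jacobi identity for finitely many pairs of generators. -/
theorem bracketOn_jacobi (s : Finset M.ι) (hx : x ∈ parPart M P p) (hy : y ∈ parPart M P q)
    (hz : z ∈ parPart M P r) :
    bracketOn 𝕜 s x (bracketOn 𝕜 s y z) = bracketOn 𝕜 s (bracketOn 𝕜 s x y) z +
      koszul p q • bracketOn 𝕜 s y (bracketOn 𝕜 s x z) := by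
  have hxy : bracketOn 𝕜 s x y ∈ parPart M P (p + q) := by
    rw [bracketOn_eq_br s hx]
    exact AddSubgroup.add_mem _ (conv_mem_parPart _ hx hy)
      (HamiltonianData.symp_mem (H := hamiltonianData M 𝕜 P s) hx hy)
  rw [bracketOn_eq_br s hxy]
  simp only [bracketOn_eq_br s hx, bracketOn_eq_br s hy]
  exact HamiltonianData.br_jacobi (H := hamiltonianData M 𝕜 P s) hx hy hz

theorem bracketOn_leibniz (s : Finset M.ι) (hx : x ∈ parPart M P p) (hy : y ∈ parPart M P q)
    (hz : z ∈ parPart M P r) :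
    bracketOn 𝕜 s x (y * z) =
      bracketOn 𝕜 s x y * z + koszul p q • (y * bracketOn 𝕜 s x z) := by
  simp only [bracketOn_eq_br s hx]
  exact HamiltonianData.br_leibniz (H := hamiltonianData M 𝕜 P s) hx hy hz

end Bracket

end BFV

namespace BFV
variable {M : GhostBasis} {𝕜 P : Type*} [Field 𝕜] [CommRing P] [Algebra 𝕜 P]
variable {j k l : ℤ} {x y z : Series M P}

/-! ### Passing to infinitely many pairs of generators -/

theorem mul_mem_comp (hx : x ∈ comp M P 𝕜 j) (hy : y ∈ comp M P 𝕜 k) :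
    x * y ∈ comp M P 𝕜 (j + k) := by
  intro m hm
  rw [mul_eq_conv ℤ] at hm
  obtain ⟨h, a, b, rfl, ha, hb⟩ := conv_app_ne hm
  exact ⟨h, by rw [degree_add, (hx a ha).2, (hy b hb).2]⟩

theorem allowed_of_mul_ne {m : Expo M} (h : (x * y) m ≠ 0) : Allowed m := by
  rw [mul_eq_conv ℤ] at h
  exact (conv_app_ne h).1

theorem term_mem_comp (hx : x ∈ comp M P 𝕜 j) (hy : y ∈ comp M P 𝕜 k) (m : Expo M) (i : M.ι)
    (h : term x y m i ≠ 0) : Allowed m ∧ degree m = j + k := by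
  refine ⟨?_, ?_⟩
  · by_contra hm
    have h1 : (rightD (ee i) x * leftD (es i) y) m = 0 :=
      by_contra fun h => hm (allowed_of_mul_ne h)
    have h2 : (rightD (es i) x * leftD (ee i) y) m = 0 :=
      by_contra fun h => hm (allowed_of_mul_ne h)
    exact h (by rw [term, h1, h2, mul_zero, sub_zero])
  · obtain ⟨a, b, rfl, ⟨ha, hb⟩ | ⟨ha, hb⟩⟩ := term_ne h
    all_goals
      have h1 := (hx _ ha).2
      have h2 := (hy _ hb).2
      rw [degree_add, degree_single] at h1 h2
      rw [degree_add]
      simp only [genDeg_ee, genDeg_es] at h1 h2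
      omega

/-- The pairs of generators that may contribute to the coefficient of `z ^ m` in the bracket of a
series of degree `j` with another one. -/
noncomputable def pairSet (j : ℤ) (m : Expo M) : Finset M.ι :=
  (Set.Finite.biUnion (Finset.finite_toSet (Finset.HasAntidiagonal.antidiagonal m))
    fun ab _ => M.finite_deg (degree ab.1 - j).natAbs).toFinset

theorem mem_pairSet (hx : x ∈ comp M P 𝕜 j) {m : Expo M} {i : M.ι} (h : term x y m i ≠ 0) :
    i ∈ pairSet j m := by
  rw [pairSet, Set.Finite.mem_toFinset, Set.mem_iUnion₂]
  obtain ⟨a, b, hab, h⟩ := term_ne h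
  refine ⟨(a, b), Finset.HasAntidiagonal.mem_antidiagonal.2 hab, ?_⟩
  change M.deg i = (degree a - j).natAbs
  rcases h with ⟨h, -⟩ | ⟨h, -⟩
  · have := (hx _ h).2
    rw [degree_add, degree_single, genDeg_ee] at this
    omega
  · have := (hx _ h).2
    rw [degree_add, degree_single, genDeg_es] at this
    omega

/-- The coefficientwise eventual equality of a family `u` of series with the series `x`. -/
def EventuallyEq (u : Finset M.ι → Series M P) (x : Series M P) : Prop :=
  ∀ m, ∀ᶠ s in Filter.atTop, u s m = x m

theorem eventuallyEq_const {P : Type*} (x : Series M P) : EventuallyEq (fun _ => x) x :=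
  fun _ => Filter.Eventually.of_forall fun _ => rfl

namespace EventuallyEq

variable {u v : Finset M.ι → Series M P}

theorem leftD (h : EventuallyEq u x) (g : Gen M) :
    EventuallyEq (fun s => leftD g (u s)) (BFV.leftD g x) := by
  intro m
  filter_upwards [h (m + Finsupp.single g 1)] with s hs
  rw [BFV.leftD, BFV.leftD, hs]

theorem rightD (h : EventuallyEq u x) (g : Gen M) :
    EventuallyEq (fun s => rightD g (u s)) (BFV.rightD g x) := by
  intro m
  filter_upwards [h (m + Finsupp.single g 1)] with s hs
  rw [BFV.rightD, BFV.rightD, hs]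

theorem conv {𝕜 : Type*} [CommRing 𝕜] [Algebra 𝕜 P] {β : P →ₗ[𝕜] P →ₗ[𝕜] P}
    (hu : EventuallyEq u x) (hv : EventuallyEq v y) :
    EventuallyEq (fun s => conv β (u s) (v s)) (BFV.conv β x y) := by
  intro m
  have h : ∀ᶠ s in Filter.atTop, ∀ ab ∈ Finset.HasAntidiagonal.antidiagonal m,
      u s ab.1 = x ab.1 ∧ v s ab.2 = y ab.2 :=
    (Filter.eventually_all_finset _).2 fun ab _ => (hu ab.1).and (hv ab.2)
  filter_upwards [h] with s hs
  by_cases hm : Allowed m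
  · rw [conv_app hm, conv_app hm]
    exact Finset.sum_congr rfl fun ab hab => by rw [(hs ab hab).1, (hs ab hab).2]
  · rw [conv_app_of_not hm, conv_app_of_not hm]

theorem mul (hu : EventuallyEq u x) (hv : EventuallyEq v y) :
    EventuallyEq (fun s => u s * v s) (x * y) := by
  simp only [mul_eq_conv ℤ]
  exact hu.conv hv

theorem bracketOn [PoissonAlgebra 𝕜 P] (hu : EventuallyEq u x) (hv : EventuallyEq v y)
    (s : Finset M.ι) :
    EventuallyEq (fun t => BFV.bracketOn 𝕜 s (u t) (v t)) (BFV.bracketOn 𝕜 s x y) := by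
  intro m
  have h1 := (hu.conv (β := PoissonAlgebra.bracket (𝕜 := 𝕜)) hv) m
  have h2 : ∀ᶠ t in Filter.atTop, ∀ i ∈ s, term (u t) (v t) m i = term x y m i := by
    refine (Filter.eventually_all_finset _).2 fun i _ => ?_
    filter_upwards [((hu.rightD (ee i)).mul (hv.leftD (es i))) m,
      ((hu.rightD (es i)).mul (hv.leftD (ee i))) m] with t h3 h4
    rw [term, term, h3, h4]
  filter_upwards [h1, h2] with t h3 h4
  rw [BFV.bracketOn, BFV.bracketOn, bracketP_eq_conv, bracketP_eq_conv, h3,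
    Finset.sum_congr rfl h4]

end EventuallyEq

section Bracket

variable [PoissonAlgebra 𝕜 P]

theorem bracketOn_eq (hx : x ∈ comp M P 𝕜 j) {m : Expo M} {s : Finset M.ι}
    (hs : pairSet j m ⊆ s) (y : Series M P) :
    bracketOn 𝕜 s x y m = bracketOn 𝕜 (pairSet j m) x y m := by
  rw [bracketOn, bracketOn, Finset.sum_subset hs]
  intro i _ hi
  by_contra h
  exact hi (mem_pairSet hx h)

theorem bracket_eq_bracketOn (hx : x ∈ comp M P 𝕜 j) (m : Expo M) (y : Series M P) :
    bracket 𝕜 x y m = bracketOn 𝕜 (pairSet j m) x y m := by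
  rw [bracket_app, bracketOn, finsum_eq_sum_of_support_subset]
  intro i hi
  exact mem_pairSet hx hi

/-- On homogeneous series, the bracket is the limit of the brackets with finitely many pairs of
generators. -/
theorem EventuallyEq.bracket {u v : Finset M.ι → Series M P} (hu : EventuallyEq u x)
    (huj : ∀ s, u s ∈ comp M P 𝕜 j) (hx : x ∈ comp M P 𝕜 j) (hv : EventuallyEq v y) :
    EventuallyEq (fun s => BFV.bracketOn 𝕜 s (u s) (v s)) (BFV.bracket 𝕜 x y) := by
  intro m
  filter_upwards [hu.bracketOn (𝕜 := 𝕜) hv (pairSet j m) m,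
    Filter.eventually_ge_atTop (pairSet j m)] with s h1 h2
  rw [bracketOn_eq (huj s) h2, h1, bracket_eq_bracketOn hx]

theorem bracketOn_mem_comp (s : Finset M.ι) (hx : x ∈ comp M P 𝕜 j) (hy : y ∈ comp M P 𝕜 k) :
    bracketOn 𝕜 s x y ∈ comp M P 𝕜 (j + k) := by
  intro m hm
  by_cases h : bracketP 𝕜 x y m = 0
  · rw [bracketOn, h, zero_add] at hm
    obtain ⟨i, -, hi⟩ := Finset.exists_ne_zero_of_sum_ne_zero hm
    exact term_mem_comp hx hy m i hi
  · rw [bracketP_eq_conv] at h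
    obtain ⟨h, a, b, rfl, ha, hb⟩ := conv_app_ne h
    exact ⟨h, by rw [degree_add, (hx a ha).2, (hy b hb).2]⟩

theorem bracket_mem_comp (hx : x ∈ comp M P 𝕜 j) (hy : y ∈ comp M P 𝕜 k) :
    bracket 𝕜 x y ∈ comp M P 𝕜 (j + k) := by
  intro m hm
  rw [bracket_eq_bracketOn hx] at hm
  exact bracketOn_mem_comp _ hx hy m hm

/-- The graded Jacobi identity on `X`: each coefficient involves only finitely many pairs of
generators. -/
theorem bracket_jacobi (hx : x ∈ comp M P 𝕜 j) (hy : y ∈ comp M P 𝕜 k) (hz : z ∈ comp M P 𝕜 l) :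
    bracket 𝕜 x (bracket 𝕜 y z) = bracket 𝕜 (bracket 𝕜 x y) z +
      koszul j k • bracket 𝕜 y (bracket 𝕜 x z) := by
  refine series_ext fun m => ?_
  have ex := eventuallyEq_const (M := M) x
  have ey := eventuallyEq_const (M := M) y
  have ez := eventuallyEq_const (M := M) z
  have exy := ex.bracket (𝕜 := 𝕜) (fun _ => hx) hx ey
  have h1 := ex.bracket (fun _ => hx) hx (ey.bracket (𝕜 := 𝕜) (fun _ => hy) hy ez) m
  have h2 := exy.bracket (𝕜 := 𝕜) (fun s => bracketOn_mem_comp s hx hy) (bracket_mem_comp hx hy)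
    ez m
  have h3 := ey.bracket (fun _ => hy) hy (ex.bracket (𝕜 := 𝕜) (fun _ => hx) hx ez) m
  obtain ⟨s, h1, h2, h3⟩ := (h1.and (h2.and h3)).exists
  rw [add_app, zsmul_app, ← h1, ← h2, ← h3, ← zsmul_app, ← add_app]
  exact congrArg (fun w : Series M P => w m)
    (bracketOn_jacobi s (comp_le_parPart hx) (comp_le_parPart hy) (comp_le_parPart hz))

theorem bracket_leibniz (hx : x ∈ comp M P 𝕜 j) (hy : y ∈ comp M P 𝕜 k)
    (hz : z ∈ comp M P 𝕜 l) :
    bracket 𝕜 x (y * z) = bracket 𝕜 x y * z + koszul j k • (y * bracket 𝕜 x z) := by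
  refine series_ext fun m => ?_
  have ex := eventuallyEq_const (M := M) x
  have ey := eventuallyEq_const (M := M) y
  have ez := eventuallyEq_const (M := M) z
  have h1 := ex.bracket (𝕜 := 𝕜) (fun _ => hx) hx (eventuallyEq_const (y * z)) m
  have h2 := (ex.bracket (𝕜 := 𝕜) (fun _ => hx) hx ey).mul ez m
  have h3 := ey.mul (ex.bracket (𝕜 := 𝕜) (fun _ => hx) hx ez) m
  obtain ⟨s, h1, h2, h3⟩ := (h1.and (h2.and h3)).exists
  rw [add_app, zsmul_app, ← h1, ← h2, ← h3, ← zsmul_app, ← add_app]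
  exact congrArg (fun w : Series M P => w m)
    (bracketOn_leibniz s (comp_le_parPart hx) (comp_le_parPart hy) (comp_le_parPart hz))

theorem bracket_zero_left (x : Series M P) : bracket 𝕜 0 x = 0 := by
  refine series_ext fun m => ?_
  by_contra h
  rcases bracket_app_ne 𝕜 h with ⟨a, b, -, ha, -⟩ | ⟨i, hi⟩
  · exact ha rfl
  · obtain ⟨a, b, -, ⟨h, -⟩ | ⟨h, -⟩⟩ := term_ne hi
    · exact h rfl
    · exact h rfl

theorem bracket_zero_right (x : Series M P) : bracket 𝕜 x 0 = 0 := by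
  refine series_ext fun m => ?_
  by_contra h
  rcases bracket_app_ne 𝕜 h with ⟨a, b, -, -, ha⟩ | ⟨i, hi⟩
  · exact ha rfl
  · obtain ⟨a, b, -, ⟨-, h⟩ | ⟨-, h⟩⟩ := term_ne hi
    · exact h rfl
    · exact h rfl

/-! ### The differential -/

variable {R : comp M P 𝕜 1}

theorem dR_apply (x : Series M P) : dR 𝕜 R x = bracket 𝕜 R.1 x := rfl

theorem dR_mem_comp (hx : x ∈ comp M P 𝕜 j) : dR 𝕜 R x ∈ comp M P 𝕜 (j + 1) := by
  rw [add_comm]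
  exact bracket_mem_comp R.2 hx

/-- The master equation implies that `d_R` is a differential; this uses the invertibility of `2`. -/
theorem dR_dR [CharZero 𝕜] (hR : bracket 𝕜 R.1 R.1 = 0) (hx : x ∈ comp M P 𝕜 j) :
    dR 𝕜 R (dR 𝕜 R x) = 0 := by
  have h := bracket_jacobi R.2 R.2 hx
  rw [hR, bracket_zero_left, zero_add, show koszul ((1 : ℤ) : ZMod 2) ((1 : ℤ) : ZMod 2) = -1 from
    rfl, neg_one_smul, ← dR_apply, ← dR_apply] at h
  have h2 : (2 : 𝕜) • dR 𝕜 R (dR 𝕜 R x) = 0 := by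
    rw [two_smul]
    nth_rw 1 [h]
    rw [neg_add_cancel]
  have h3 := congrArg (fun y => (2 : 𝕜)⁻¹ • y) h2
  simpa [smul_smul] using h3

theorem dR_mul (hx : x ∈ comp M P 𝕜 0) (hy : y ∈ comp M P 𝕜 j) :
    dR 𝕜 R (x * y) = dR 𝕜 R x * y + x * dR 𝕜 R y := by
  have h := bracket_leibniz R.2 hx hy
  rwa [Int.cast_zero, koszul_zero_right, one_smul] at h

theorem dR_bracket (hx : x ∈ comp M P 𝕜 0) (hy : y ∈ comp M P 𝕜 j) :
    dR 𝕜 R (bracket 𝕜 x y) = bracket 𝕜 (dR 𝕜 R x) y + bracket 𝕜 x (dR 𝕜 R y) := by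
  have h := bracket_jacobi R.2 hx hy
  rwa [Int.cast_zero, koszul_zero_right, one_smul] at h

end Bracket

end BFV

namespace BFV
variable {M : GhostBasis}

/-! ### Monomials of nonpositive and of nonnegative degree -/

theorem gen_cases (g : Gen M) : (∃ i, g = ee i) ∨ ∃ i, g = es i := by
  rcases h : ofLex g with i | i
  · exact Or.inl ⟨i, congrArg toLex h⟩
  · exact Or.inr ⟨i, congrArg toLex h⟩

theorem genGhost_ee (i : M.ι) : genGhost (ee i) = 0 := rfl

theorem genGhost_es (i : M.ι) : genGhost (es i) = M.deg i := rfl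

theorem ghost_eq_zero {m : Expo M} : ghost m = 0 ↔ ∀ i, m (es i) = 0 := by
  rw [ghost, Finsupp.sum, Finset.sum_eq_zero_iff]
  constructor
  · intro h i
    by_contra hi
    have := h (es i) (Finsupp.mem_support_iff.2 hi)
    rw [genGhost_es] at this
    exact (mul_ne_zero hi (M.deg_pos i).ne') this
  · intro h g _
    rcases gen_cases g with ⟨i, rfl⟩ | ⟨i, rfl⟩
    · rw [genGhost_ee, mul_zero]
    · rw [h, zero_mul]

/-- The monomials in the generators `e* i`. -/
def IsPos (m : Expo M) : Prop := ∀ i, m (ee i) = 0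

theorem IsPos.degree_eq {m : Expo M} (h : IsPos m) : degree m = ghost m := by
  rw [degree, ghost, Finsupp.sum, Finsupp.sum]
  push_cast
  refine Finset.sum_congr rfl fun g _ => ?_
  rcases gen_cases g with ⟨i, rfl⟩ | ⟨i, rfl⟩
  · rw [h, Nat.cast_zero, zero_mul, zero_mul]
  · rfl

theorem IsPos.eq_zero {m : Expo M} (h : IsPos m) (h0 : ghost m = 0) : m = 0 := by
  ext g
  rcases gen_cases g with ⟨i, rfl⟩ | ⟨i, rfl⟩
  · exact h i
  · exact ghost_eq_zero.1 h0 i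

theorem isPos_single (i : M.ι) : IsPos (Finsupp.single (es i : Gen M) 1) := by
  intro j
  refine Finsupp.single_eq_of_ne ?_
  intro h
  cases h

theorem allowed_single (g : Gen M) : Allowed (Finsupp.single g 1) := by
  intro h _
  rcases eq_or_ne h g with rfl | hg
  · rw [Finsupp.single_eq_same]
  · rw [Finsupp.single_eq_of_ne hg]
    exact Nat.zero_le 1

theorem IsPos.eq_single {m : Expo M} (h : IsPos m) (h1 : ghost m = 1) :
    ∃ i, M.deg i = 1 ∧ m = Finsupp.single (es i) 1 := by
  have h0 : ¬ ∀ i, m (es i) = 0 := by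
    rw [← ghost_eq_zero, h1]
    exact one_ne_zero
  push Not at h0
  obtain ⟨i, hi⟩ := h0
  have hle : Finsupp.single (es i) 1 ≤ m :=
    Finsupp.single_le_iff.2 (Nat.one_le_iff_ne_zero.2 hi)
  have hm := tsub_add_cancel_of_le hle
  have hg := congrArg ghost hm
  rw [ghost_add, ghost_single, genGhost_es, h1] at hg
  have hd := M.deg_pos i
  refine ⟨i, by omega, ?_⟩
  have h2 : IsPos (m - Finsupp.single (es i) 1) := fun j => by
    rw [Finsupp.tsub_apply, h j, Nat.zero_sub]
  rw [h2.eq_zero (by omega), zero_add] at hm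
  exact hm.symm

/-- In the normal form, the factors of negative degree come first. -/
theorem sgn_eq_one {n α : Expo M} (hn : ghost n = 0) (hα : IsPos α) : sgn n α = 1 := by
  rw [sgn]
  convert pow_zero (-1 : ℤ)
  refine Finset.sum_eq_zero fun g hg => Finset.sum_eq_zero fun h hh => ?_
  rw [Finsupp.mem_support_iff] at hg hh
  refine if_neg ?_
  rcases gen_cases g with ⟨i, rfl⟩ | ⟨i, rfl⟩
  · rcases gen_cases h with ⟨j, rfl⟩ | ⟨j, rfl⟩
    · exact absurd (hα j) hh
    · exact Sum.Lex.not_inr_lt_inl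
  · exact absurd (ghost_eq_zero.1 hn i) hg

theorem allowed_add {n α : Expo M} (hn : ghost n = 0) (hα : IsPos α) (h1 : Allowed n)
    (h2 : Allowed α) : Allowed (n + α) := by
  intro g hg
  rw [Finsupp.add_apply]
  rcases gen_cases g with ⟨i, rfl⟩ | ⟨i, rfl⟩
  · rw [hα, add_zero]
    exact h1 _ hg
  · rw [ghost_eq_zero.1 hn, zero_add]
    exact h2 _ hg

theorem eq_zero_of_degree_eq_zero {m : Expo M} (hg : ghost m = 0) (hd : degree m = 0) :
    m = 0 := by
  ext g
  rcases gen_cases g with ⟨i, rfl⟩ | ⟨i, rfl⟩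
  · by_contra h
    have hm := tsub_add_cancel_of_le
      (Finsupp.single_le_iff.2 (Nat.one_le_iff_ne_zero.2 h) : Finsupp.single (ee i) 1 ≤ m)
    have h1 := M.deg_pos i
    have h2 := degree_le_ghost (m - Finsupp.single (ee i) 1)
    rw [← hm, ghost_add] at hg
    rw [← hm, degree_add, degree_single, genDeg_ee] at hd
    omega
  · exact ghost_eq_zero.1 hg i

/-- The part of a monomial of positive degree. -/
noncomputable def posPart (m : Expo M) : Expo M := m.filter fun g => (ofLex g).isRight = true

/-- The part of a monomial of negative degree. -/
noncomputable def negPart (m : Expo M) : Expo M := m.filter fun g => ¬ (ofLex g).isRight = true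

theorem negPart_add_posPart (m : Expo M) : negPart m + posPart m = m := by
  rw [add_comm]
  exact Finsupp.filter_add_filter_not m _

theorem isPos_posPart (m : Expo M) : IsPos (posPart m) := fun i =>
  Finsupp.filter_apply_neg _ _ (by simp [ee, Sum.inlₗ])

theorem ghost_negPart (m : Expo M) : ghost (negPart m) = 0 :=
  ghost_eq_zero.2 fun i => Finsupp.filter_apply_neg _ _ (by simp [es, Sum.inrₗ])

theorem ghost_posPart (m : Expo M) : ghost (posPart m) = ghost m := by
  conv_rhs => rw [← negPart_add_posPart m, ghost_add, ghost_negPart, zero_add]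

theorem parts_add {n α : Expo M} (hn : ghost n = 0) (hα : IsPos α) :
    negPart (n + α) = n ∧ posPart (n + α) = α := by
  have h : ∀ i, n (es i) = 0 := ghost_eq_zero.1 hn
  have h1 : posPart (n + α) = α := by
    ext g
    rcases gen_cases g with ⟨i, rfl⟩ | ⟨i, rfl⟩
    · rw [isPos_posPart, hα]
    · rw [posPart, Finsupp.filter_apply_pos _ _ (by simp [es, Sum.inrₗ]), Finsupp.add_apply, h,
        zero_add]
  refine ⟨?_, h1⟩
  have h2 := negPart_add_posPart (n + α)
  rw [h1] at h2
  exact add_right_cancel h2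

/-! ### The differential on the associated graded complex -/

variable {𝕜 P : Type*} [Field 𝕜] [CommRing P] [Algebra 𝕜 P]
variable {j : ℤ} {p : ℕ} {x y z : Series M P}

/-- The coefficient of the monomial `z ^ α` in `x`, as a series. -/
noncomputable def slice (α : Expo M) (x : Series M P) : Series M P := fun n => x (n + α)

theorem slice_mem_comp {α : Expo M} (hα : IsPos α) (hx : x ∈ comp M P 𝕜 j) :
    slice α x ∈ comp M P 𝕜 (j - ghost α) := by
  intro n hn
  obtain ⟨h1, h2⟩ := hx _ hn
  refine ⟨h1.of_le le_self_add, ?_⟩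
  rw [degree_add, hα.degree_eq] at h2
  omega

theorem mem_filt_one : x ∈ filt M P 𝕜 1 ↔ ∀ m, ghost m = 0 → x m = 0 := by
  constructor
  · intro h m hm
    by_contra h0
    have := h m h0
    omega
  · intro h m hm
    by_contra h0
    exact hm (h m (by omega))

theorem sub_const_mem_filt (hx : x ∈ comp M P 𝕜 0) : x - const (x 0) ∈ filt M P 𝕜 1 := by
  refine mem_filt_one.2 fun m hm => ?_
  rw [sub_app, const]
  by_cases h : m = 0
  · rw [if_pos h, h, sub_self]
  · rw [if_neg h, sub_zero]
    by_contra h0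
    exact h (eq_zero_of_degree_eq_zero hm (hx _ h0).2)

variable {R : comp M P 𝕜 1}

/-- As `R` has degree `1`, a term of `R` with the factor `e i` has factors of positive degree
that compensate for it. -/
theorem one_add_ghost_le {a : Expo M} {i : M.ι}
    (h : R.1 (a + Finsupp.single (ee i) 1) ≠ 0) : 1 + M.deg i ≤ ghost a := by
  have h1 := (R.2 _ h).2
  have h2 := degree_le_ghost a
  rw [degree_add, degree_single, genDeg_ee] at h1
  omega

theorem one_le_ghost {a : Expo M} (h : R.1 a ≠ 0) : 1 ≤ ghost a := by
  have h1 := (R.2 _ h).2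
  have h2 := degree_le_ghost a
  omega

variable [PoissonAlgebra 𝕜 P]

/-- The differential `d_R` preserves the filtration. -/
theorem dR_mem_filt (hx : x ∈ filt M P 𝕜 p) : dR 𝕜 R x ∈ filt M P 𝕜 p := by
  intro m hm
  rcases bracket_app_ne 𝕜 hm with ⟨a, b, rfl, -, hb⟩ | ⟨i, hi⟩
  · have := hx b hb
    rw [ghost_add]
    omega
  · obtain ⟨a, b, rfl, ⟨h1, h2⟩ | ⟨-, h2⟩⟩ := term_ne hi
    · have h1 := one_add_ghost_le h1
      have h2 := hx _ h2
      rw [ghost_add, ghost_single, genGhost_es] at h2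
      rw [ghost_add]
      omega
    · have h2 := hx _ h2
      rw [ghost_add, ghost_single, genGhost_ee] at h2
      rw [ghost_add]
      omega

/-- On `F^p X / F^(p+1) X`, the differential `d_R` is the differential of `X/I` applied to the
coefficients of the monomials in the `e* i` of degree `p`. -/
theorem dR_app_add (hx : x ∈ filt M P 𝕜 p) {n α : Expo M} (hn : ghost n = 0) (hα : IsPos α)
    (hαA : Allowed α) (hp : ghost α = p) : dR 𝕜 R x (n + α) = dR 𝕜 R (slice α x) n := by
  have hg : ghost (n + α) = p := by rw [ghost_add, hn, hp, zero_add]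
  rw [dR_apply, dR_apply, bracket_app, bracket_app]
  congr 1
  · have h1 : bracketP 𝕜 R.1 x (n + α) = 0 := by
      by_contra h
      obtain ⟨a, b, hab, ha, hb⟩ := bracketP_app_ne 𝕜 h
      have h1 := one_le_ghost ha
      have h2 := hx _ hb
      rw [← hab, ghost_add] at hg
      omega
    have h2 : bracketP 𝕜 R.1 (slice α x) n = 0 := by
      by_contra h
      obtain ⟨a, b, hab, ha, hb⟩ := bracketP_app_ne 𝕜 h
      have h1 := one_le_ghost ha
      rw [← hab, ghost_add] at hn
      omega
    rw [h1, h2]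
  · refine finsum_congr fun i => ?_
    have h1 : (rightD (ee i) R.1 * leftD (es i) x) (n + α) = 0 := by
      by_contra h
      obtain ⟨a, b, hab, ha, hb⟩ := mul_app_ne h
      have h1 := one_add_ghost_le (rightD_app_ne ha)
      have h2 := hx _ (leftD_app_ne hb)
      rw [ghost_add, ghost_single, genGhost_es] at h2
      rw [← hab, ghost_add] at hg
      omega
    have h2 : (rightD (ee i) R.1 * leftD (es i) (slice α x)) n = 0 := by
      by_contra h
      obtain ⟨a, b, hab, ha, hb⟩ := mul_app_ne h
      have h1 := one_add_ghost_le (rightD_app_ne ha)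
      rw [← hab, ghost_add] at hn
      omega
    have h3 : (rightD (es i) R.1 * leftD (ee i) x) (n + α) =
        (rightD (es i) R.1 * leftD (ee i) (slice α x)) n := by
      rw [mul_eq_conv ℤ, mul_eq_conv ℤ]
      by_cases hA : Allowed n
      swap
      · rw [conv_app_of_not hA, conv_app_of_not fun h => hA (h.of_le le_self_add)]
      rw [conv_app hA, conv_app (allowed_add hn hα hA hαA), sum_antidiagonal_add_right]
      · refine Finset.sum_congr rfl fun ab hab => ?_
        rw [Finset.HasAntidiagonal.mem_antidiagonal] at hab
        have ha : ghost ab.1 = 0 := by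
          rw [← hab, ghost_add] at hn
          omega
        have he : ghost (Finsupp.single (ee i : Gen M) 1) = 0 := by
          rw [ghost_single, genGhost_ee]
        have h4 : leftD (ee i) x (ab.2 + α) = leftD (ee i) (slice α x) ab.2 := by
          rw [leftD, leftD, slice, sgn_add_right, sgn_eq_one he hα, mul_one, Finsupp.add_apply,
            hα i, add_zero, add_right_comm]
        rw [h4, sgn_add_right, sgn_eq_one ha hα, mul_one]
      · intro a b hab h
        -- `b` contains all factors of positive degree, since its ghost degree is at least `p`
        suffices leftD (ee i) x b = 0 by rw [this, map_zero, smul_zero]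
        by_contra hb
        refine h fun g => ?_
        have h2 := hx _ (leftD_app_ne hb)
        rw [ghost_add, ghost_single, genGhost_ee] at h2
        rw [← hab, ghost_add] at hg
        have ha : ghost a = 0 := by omega
        rcases gen_cases g with ⟨k, rfl⟩ | ⟨k, rfl⟩
        · rw [hα k]
          exact Nat.zero_le _
        · have h3 := DFunLike.congr_fun hab (es k)
          rw [Finsupp.add_apply, Finsupp.add_apply, ghost_eq_zero.1 ha, ghost_eq_zero.1 hn,
            zero_add, zero_add] at h3
          exact h3.ge
    rw [term, term, h1, h2, h3]

/-- If the coefficients of `x ∈ F^p X` are coboundaries in `X/I`, then `x` is a coboundary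
modulo `F^(p+1) X`. -/
theorem exists_sub_dR_mem_filt (hx : x ∈ comp M P 𝕜 j) (hp : x ∈ filt M P 𝕜 p)
    (h : ∀ α, IsPos α → Allowed α → ghost α = p →
      ∃ y ∈ comp M P 𝕜 (j - p - 1), slice α x - dR 𝕜 R y ∈ filt M P 𝕜 1) :
    ∃ y ∈ comp M P 𝕜 (j - 1), y ∈ filt M P 𝕜 p ∧ x - dR 𝕜 R y ∈ filt M P 𝕜 (p + 1) := by
  have h' : ∀ α, ∃ y ∈ comp M P 𝕜 (j - p - 1), IsPos α → Allowed α → ghost α = p →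
      slice α x - dR 𝕜 R y ∈ filt M P 𝕜 1 := by
    intro α
    by_cases hα : IsPos α ∧ Allowed α ∧ ghost α = p
    · obtain ⟨y, hy, h2⟩ := h α hα.1 hα.2.1 hα.2.2
      exact ⟨y, hy, fun _ _ _ => h2⟩
    · exact ⟨0, Submodule.zero_mem _, fun h1 h2 h3 => absurd ⟨h1, h2, h3⟩ hα⟩
  choose Y hY hYx using h'
  -- `y` is the sum of the series `Y α * z ^ α`, over all `α` of degree `p`
  classical
  let y : Series M P := fun m =>
    if ghost m = p ∧ Allowed m then Y (posPart m) (negPart m) else 0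
  have hy : ∀ m, y m = if ghost m = p ∧ Allowed m then Y (posPart m) (negPart m) else 0 :=
    fun _ => rfl
  have hyj : y ∈ comp M P 𝕜 (j - 1) := by
    intro m hm
    by_cases hc : ghost m = p ∧ Allowed m
    swap
    · exact absurd (if_neg hc) hm
    rw [hy, if_pos hc] at hm
    refine ⟨hc.2, ?_⟩
    have h1 := (hY _ _ hm).2
    rw [← negPart_add_posPart m, degree_add, h1, (isPos_posPart m).degree_eq, ghost_posPart, hc.1]
    ring
  have hyp : y ∈ filt M P 𝕜 p := by
    intro m hm
    by_contra hc
    exact hm (if_neg fun h => hc h.1.ge)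
  refine ⟨y, hyj, hyp, fun m hm => ?_⟩
  by_contra hlt
  have hmp : p ≤ ghost m := Submodule.sub_mem _ hp (dR_mem_filt (R := R) hyp) m hm
  have hgm : ghost m = p := by omega
  have hA : Allowed m := (Submodule.sub_mem _ hx
    (by simpa using dR_mem_comp (R := R) hyj : dR 𝕜 R y ∈ comp M P 𝕜 j) m hm).1
  refine hm ?_
  have hα := isPos_posPart m
  have hn := ghost_negPart m
  have hm' := negPart_add_posPart m
  have hαA : Allowed (posPart m) := hA.of_le (le_add_self.trans_eq hm')
  have hαp : ghost (posPart m) = p := by rw [ghost_posPart, hgm]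
  have h1 := mem_filt_one.1 (hYx _ hα hαA hαp) _ hn
  have h2 : slice (posPart m) y - Y (posPart m) ∈ filt M P 𝕜 1 := by
    refine mem_filt_one.2 fun n' hn' => ?_
    rw [sub_app, slice, hy, (parts_add hn' hα).1, (parts_add hn' hα).2, ghost_add, hn', hαp,
      zero_add]
    by_cases hA' : Allowed n'
    · rw [if_pos ⟨rfl, allowed_add hn' hα hA' hαA⟩, sub_self]
    · have h0 : Y (posPart m) n' = 0 := by
        by_contra h0
        exact hA' (hY _ _ h0).1
      rw [h0, ite_self, sub_zero]
  have h3 := mem_filt_one.1 (dR_mem_filt (R := R) h2) _ hn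
  have h4 := dR_app_add (R := R) hyp hn hα hαA hαp
  rw [hm'] at h4
  rw [map_sub, sub_app] at h3
  rw [sub_app, slice, hm'] at h1
  rw [sub_app, h4]
  linear_combination h1 - h3

/-! ### Acyclicity in the positive part of the filtration -/

variable {J : Ideal P}

/-- The acyclicity of `X/I`, for representatives in `X`. -/
theorem IsBFVModel.exists_sub_dR_mem (hR : IsBFVModel 𝕜 J R) (hj : j ≠ 0)
    (hx : x ∈ comp M P 𝕜 j) (h : dR 𝕜 R x ∈ filt M P 𝕜 1) :
    ∃ y ∈ comp M P 𝕜 (j - 1), x - dR 𝕜 R y ∈ filt M P 𝕜 1 := by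
  have hc : (filt M P 𝕜 1).mkQ x ∈ cocycles (dRbar 𝕜 R) (compBar M P 𝕜) j :=
    ⟨⟨x, hx, rfl⟩, (Submodule.Quotient.mk_eq_zero _).2 h⟩
  have h0 := (hR.acyclic j hj).elim (Submodule.Quotient.mk ⟨_, hc⟩) 0
  rw [Submodule.Quotient.mk_eq_zero] at h0
  obtain ⟨-, ⟨y, hy, rfl⟩, h1⟩ := h0
  exact ⟨y, hy, (Submodule.Quotient.eq _).1 h1.symm⟩

/-- An element of `F^p X^j` which is closed modulo `F^(p+1) X` is exact modulo `F^(p+1) X`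
if `p ≠ j`. -/
theorem IsBFVModel.exists_sub_dR_mem_filt (hR : IsBFVModel 𝕜 J R) (hj : (p : ℤ) ≠ j)
    (hx : x ∈ comp M P 𝕜 j) (hp : x ∈ filt M P 𝕜 p) (h : dR 𝕜 R x ∈ filt M P 𝕜 (p + 1)) :
    ∃ y ∈ comp M P 𝕜 (j - 1), y ∈ filt M P 𝕜 p ∧ x - dR 𝕜 R y ∈ filt M P 𝕜 (p + 1) := by
  refine BFV.exists_sub_dR_mem_filt hx hp fun α hα hαA hαp => ?_
  have h1 := slice_mem_comp hα hx
  rw [hαp] at h1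
  refine hR.exists_sub_dR_mem (by omega) h1 (mem_filt_one.2 fun n hn => ?_)
  rw [← dR_app_add hp hn hα hαA hαp]
  by_contra h0
  have h2 := h _ h0
  rw [ghost_add, hn, hαp] at h2
  omega

/-- Closed elements of `F^p X^j` are exact if `j < p`: the corrections to ever higher order
converge. -/
theorem IsBFVModel.exists_dR_eq [CharZero 𝕜] (hR : IsBFVModel 𝕜 J R) (hj : j < p)
    (hx : x ∈ comp M P 𝕜 j) (hp : x ∈ filt M P 𝕜 p) (h : dR 𝕜 R x = 0) :
    ∃ y ∈ comp M P 𝕜 (j - 1), y ∈ filt M P 𝕜 p ∧ dR 𝕜 R y = x := by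
  -- `u` runs through the remainders of `x` after the first `k` corrections
  have step : ∀ (k : ℕ) (u : {u // u ∈ comp M P 𝕜 j ∧ u ∈ filt M P 𝕜 (p + k) ∧ dR 𝕜 R u = 0}),
      ∃ y ∈ comp M P 𝕜 (j - 1), y ∈ filt M P 𝕜 (p + k) ∧
        u.1 - dR 𝕜 R y ∈ filt M P 𝕜 (p + (k + 1)) := by
    rintro k ⟨u, hu, hup, hu0⟩
    exact hR.exists_sub_dR_mem_filt (by push_cast; omega) hu hup
      (by rw [hu0]; exact Submodule.zero_mem _)
  choose Y hYj hYp hY using step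
  let U : ∀ k : ℕ, {u // u ∈ comp M P 𝕜 j ∧ u ∈ filt M P 𝕜 (p + k) ∧ dR 𝕜 R u = 0} := fun k =>
    Nat.rec ⟨x, hx, hp, h⟩ (fun k u => ⟨u.1 - dR 𝕜 R (Y k u), Submodule.sub_mem _ u.2.1
      (by simpa using dR_mem_comp (R := R) (hYj k u)), hY k u, by
        rw [map_sub, u.2.2.2, dR_dR hR.master (hYj k u), sub_zero]⟩) k
  have hU : ∀ N, x - dR 𝕜 R (∑ k ∈ Finset.range N, Y k (U k)) = (U N).1 := by
    intro N
    induction N with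
    | zero =>
      rw [Finset.sum_range_zero, map_zero, sub_zero]
      rfl
    | succ N ih => rw [Finset.sum_range_succ, map_add, ← sub_sub, ih]
  have hz : ∀ (m : Expo M) (k : ℕ), ghost m < k → Y k (U k) m = 0 := by
    intro m k hk
    by_contra h0
    have := hYp k (U k) m h0
    omega
  -- the sum of all corrections; only those with `k ≤ ghost m` contribute at `m`
  let y : Series M P := fun m => ∑ k ∈ Finset.range (ghost m + 1), Y k (U k) m
  have hy : ∀ m, y m = ∑ k ∈ Finset.range (ghost m + 1), Y k (U k) m := fun _ => rfl
  have hne : ∀ m, y m ≠ 0 → ∃ k, Y k (U k) m ≠ 0 := fun m hm => by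
    obtain ⟨k, -, hk⟩ := Finset.exists_ne_zero_of_sum_ne_zero hm
    exact ⟨k, hk⟩
  refine ⟨y, fun m hm => ?_, fun m hm => ?_, ?_⟩
  · obtain ⟨k, hk⟩ := hne m hm
    exact hYj k _ m hk
  · obtain ⟨k, hk⟩ := hne m hm
    have := hYp k _ m hk
    omega
  · have hN : ∀ N, x - dR 𝕜 R y ∈ filt M P 𝕜 N := by
      intro N
      have h1 : y - ∑ k ∈ Finset.range N, Y k (U k) ∈ filt M P 𝕜 N := by
        intro m hm
        by_contra hlt
        refine hm ?_
        rw [sub_app, sum_app, hy, sub_eq_zero]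
        refine Finset.sum_subset (Finset.range_mono (by omega)) fun k _ hk => hz m k ?_
        rw [Finset.mem_range] at hk
        omega
      have h2 : x - dR 𝕜 R y = (U N).1 -
          dR 𝕜 R (y - ∑ k ∈ Finset.range N, Y k (U k)) := by
        rw [← hU, map_sub]
        abel
      rw [h2]
      refine Submodule.sub_mem _ (fun m hm => ?_) (dR_mem_filt h1)
      have := (U N).2.2.1 m hm
      omega
    refine series_ext fun m => ?_
    by_contra hm
    have := hN (ghost m + 1) m fun h0 => hm (by rw [sub_app, sub_eq_zero] at h0; exact h0.symm)
    omega

/-! ### Degree zero -/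

/-- The kernel of `P → H^0(X/I)` consists of the constant terms of coboundaries. -/
theorem IsBFVModel.mem_iff (hR : IsBFVModel 𝕜 J R) (a : P) :
    a ∈ J ↔ ∃ y ∈ comp M P 𝕜 (-1), dR 𝕜 R y 0 = a := by
  rw [← hR.kernel a]
  have h1 : natMap 𝕜 R a = 0 ↔
      (filt M P 𝕜 1).mkQ (const a) ∈ coboundaries (dRbar 𝕜 R) (compBar M P 𝕜) 0 :=
    Submodule.Quotient.mk_eq_zero _
  have h2 : ∀ y : Series M P, (filt M P 𝕜 1).mkQ (const a) = dRbar 𝕜 R ((filt M P 𝕜 1).mkQ y) ↔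
      const a - dR 𝕜 R y ∈ filt M P 𝕜 1 := fun y => Submodule.Quotient.eq _
  rw [h1]
  constructor
  · rintro ⟨-, ⟨y, hy, rfl⟩, h⟩
    refine ⟨y, hy, ?_⟩
    have h3 := mem_filt_one.1 ((h2 y).1 h.symm) 0 (ghost_eq_zero.2 fun _ => rfl)
    rw [sub_app, sub_eq_zero] at h3
    rw [← h3, const, if_pos rfl]
  · rintro ⟨y, hy, rfl⟩
    refine ⟨_, ⟨y, hy, rfl⟩, ((h2 y).2 ?_).symm⟩
    rw [← neg_sub]
    exact Submodule.neg_mem _ (sub_const_mem_filt (by simpa using dR_mem_comp (R := R) hy))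

/-- The degree zero analogue of `IsBFVModel.exists_sub_dR_mem`. -/
theorem IsBFVModel.exists_sub_dR_mem_zero (hR : IsBFVModel 𝕜 J R) (hx : x ∈ comp M P 𝕜 0)
    (h : x 0 ∈ J) : ∃ y ∈ comp M P 𝕜 (-1), x - dR 𝕜 R y ∈ filt M P 𝕜 1 := by
  obtain ⟨y, hy, h1⟩ := (hR.mem_iff _).1 h
  refine ⟨y, hy, ?_⟩
  have h2 := sub_const_mem_filt hx
  have h3 := sub_const_mem_filt (by simpa using dR_mem_comp (R := R) hy : dR 𝕜 R y ∈ comp M P 𝕜 0)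
  have h4 : x - dR 𝕜 R y = (x - const (x 0)) - (dR 𝕜 R y - const (x 0)) := by abel
  rw [h4]
  rw [h1] at h3
  exact Submodule.sub_mem _ h2 h3

theorem one_app_zero : (1 : Series M P) 0 = 1 := by
  change (const 1 : Series M P) 0 = 1
  rw [const, if_pos rfl]

theorem mul_app_zero (x y : Series M P) : (x * y) 0 = x 0 * y 0 := by
  have hA : Allowed (0 : Expo M) := fun _ _ => Nat.zero_le _
  rw [mul_eq_conv ℤ, conv_app hA, Finset.HasAntidiagonal.antidiagonal_zero,
    Finset.sum_singleton, sgn_zero_left, one_smul, LinearMap.mul_apply']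

theorem bracketP_app_zero (x y : Series M P) : bracketP 𝕜 x y 0 = pbr 𝕜 (x 0) (y 0) := by
  have hA : Allowed (0 : Expo M) := fun _ _ => Nat.zero_le _
  rw [bracketP_eq_conv, conv_app hA, Finset.HasAntidiagonal.antidiagonal_zero,
    Finset.sum_singleton, sgn_zero_left, one_smul, pbr]

theorem leftD_app_zero (g : Gen M) (x : Series M P) : leftD g x 0 = x (Finsupp.single g 1) := by
  simp [leftD, sgn_zero_right]

theorem rightD_app_zero (g : Gen M) (x : Series M P) : rightD g x 0 = x (Finsupp.single g 1) := by
  simp [rightD, sgn_zero_left]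

theorem term_app_zero (x y : Series M P) (i : M.ι) :
    term x y 0 i = x (Finsupp.single (ee i) 1) * y (Finsupp.single (es i) 1) -
      (-1) ^ M.deg i * (x (Finsupp.single (es i) 1) * y (Finsupp.single (ee i) 1)) := by
  rw [term, mul_app_zero, mul_app_zero, leftD_app_zero, leftD_app_zero, rightD_app_zero,
    rightD_app_zero]

theorem bracket_app_zero (hx : x ∈ comp M P 𝕜 0) (y : Series M P) :
    bracket 𝕜 x y 0 = pbr 𝕜 (x 0) (y 0) := by
  rw [bracket_app, bracketP_app_zero, finsum_eq_zero_of_forall_eq_zero, add_zero]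
  intro i
  have h := M.deg_pos i
  have h1 : x (Finsupp.single (ee i) 1) = 0 := by
    by_contra h0
    have := (hx _ h0).2
    rw [degree_single, genDeg_ee] at this
    omega
  have h2 : x (Finsupp.single (es i) 1) = 0 := by
    by_contra h0
    have := (hx _ h0).2
    rw [degree_single, genDeg_es] at this
    omega
  rw [term_app_zero, h1, h2, zero_mul, zero_mul, mul_zero, sub_zero]

/-- The constant term of a coboundary, where `R = ∑ i, R (e* i) e* i + ⋯`. -/
theorem dR_app_zero (y : Series M P) :
    dR 𝕜 R y 0 = ∑ᶠ i : M.ι,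
      -((-1) ^ M.deg i * (R.1 (Finsupp.single (es i) 1) * y (Finsupp.single (ee i) 1))) := by
  have h0 : R.1 0 = 0 := by
    by_contra h
    have := (R.2 _ h).2
    simp [degree] at this
  rw [dR_apply, bracket_app, bracketP_app_zero, h0, Reduction.pbr_zero_left, zero_add]
  refine finsum_congr fun i => ?_
  have h1 : R.1 (Finsupp.single (ee i) 1) = 0 := by
    by_contra h
    have := (R.2 _ h).2
    rw [degree_single, genDeg_ee] at this
    omega
  rw [term_app_zero, h1, zero_mul, zero_sub]

theorem dR_const_app (a : P) (m : Expo M) : dR 𝕜 R (const a) m = pbr 𝕜 (R.1 m) a := by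
  have hz : ∀ (g : Gen M), leftD g (const a : Series M P) = 0 := by
    intro g
    refine series_ext fun b => ?_
    have : b + Finsupp.single g 1 ≠ 0 := by
      intro h
      have := DFunLike.congr_fun h g
      simp at this
    rw [leftD, const, if_neg this, mul_zero, mul_zero, zero_app]
  rw [dR_apply, bracket_app, finsum_eq_zero_of_forall_eq_zero, add_zero]
  · by_cases hm : Allowed m
    · rw [bracketP_eq_conv, conv_app hm, Finset.sum_eq_single (m, 0)]
      · rw [sgn_zero_right, one_smul, const, if_pos rfl, pbr]
      · rintro ⟨b, c⟩ hbc hne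
        rw [Finset.HasAntidiagonal.mem_antidiagonal] at hbc
        have hc : c ≠ 0 := by
          rintro rfl
          exact hne (Prod.ext ((add_zero b).symm.trans hbc) rfl)
        simp only [const, if_neg hc, map_zero, smul_zero]
      · intro h
        exact absurd (Finset.HasAntidiagonal.mem_antidiagonal.2 (add_zero m)) h
    · have h0 : R.1 m = 0 := by
        by_contra h
        exact hm (R.2 _ h).1
      rw [bracketP_eq_conv, conv_app_of_not hm, h0, Reduction.pbr_zero_left]
  · intro i
    rw [term, hz, hz, mul_zero, mul_zero, zero_app, mul_zero, sub_zero]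

/-- The coefficients of `R` at the generators `e* i` belong to `J`, being up to sign the constant
terms of the coboundaries of the `e i`. -/
theorem IsBFVModel.apply_es_mem (hR : IsBFVModel 𝕜 J R) (i : M.ι) :
    R.1 (Finsupp.single (es i) 1) ∈ J := by
  by_cases hi : M.deg i = 1
  swap
  · have h0 : R.1 (Finsupp.single (es i) 1) = 0 := by
      by_contra h
      have := (R.2 _ h).2
      rw [degree_single, genDeg_es] at this
      omega
    rw [h0]
    exact J.zero_mem
  classical
  -- the constant term of `d_R (e i)` is `R (e* i)`
  let y : Series M P := fun m => if m = Finsupp.single (ee i) 1 then 1 else 0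
  have hy : y ∈ comp M P 𝕜 (-1) := by
    intro m hm
    have h : m = Finsupp.single (ee i) 1 := by
      by_contra h
      exact hm (if_neg h)
    rw [h, degree_single, genDeg_ee, hi]
    exact ⟨allowed_single _, rfl⟩
  have h := (hR.mem_iff _).2 ⟨y, hy, rfl⟩
  rw [dR_app_zero, finsum_eq_single _ i] at h
  · have h1 : y (Finsupp.single (ee i) 1) = 1 := if_pos rfl
    rw [h1, mul_one, hi, pow_one, neg_one_mul, neg_neg] at h
    exact h
  · intro k hk
    have h1 : y (Finsupp.single (ee k) 1) = 0 := by
      refine if_neg fun h => hk ?_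
      have h2 := Finsupp.single_left_injective one_ne_zero h
      exact Sum.inl_injective (toLex.injective h2)
    rw [h1, mul_zero, mul_zero, neg_zero]

/-- The coefficients of `R` at the generators `e* i` generate the ideal `J`. -/
theorem IsBFVModel.le_span (hR : IsBFVModel 𝕜 J R) :
    J ≤ Ideal.span (Set.range fun i => R.1 (Finsupp.single (es i) 1)) := by
  intro a ha
  obtain ⟨y, -, rfl⟩ := (hR.mem_iff a).1 ha
  rw [dR_app_zero]
  refine finsum_induction (· ∈ Ideal.span _) (Submodule.zero_mem _)
    (fun _ _ => Submodule.add_mem _) fun i => ?_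
  exact Submodule.neg_mem _ (Ideal.mul_mem_left _ _
    (Ideal.mul_mem_right _ _ (Ideal.subset_span ⟨i, rfl⟩)))

theorem IsBFVModel.mem_normalizer (hR : IsBFVModel 𝕜 J R) {a : P}
    (h : ∀ i, pbr 𝕜 (R.1 (Finsupp.single (es i) 1)) a ∈ J) : a ∈ Reduction.normalizer 𝕜 J := by
  intro b hb
  have hle : Ideal.span (Set.range fun i => R.1 (Finsupp.single (es i) 1)) ≤ J := by
    rw [Ideal.span_le]
    rintro _ ⟨i, rfl⟩
    exact hR.apply_es_mem i
  refine Submodule.span_induction (p := fun b _ => pbr 𝕜 a b ∈ J) ?_ ?_ ?_ ?_ (hR.le_span hb)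
  · rintro _ ⟨i, rfl⟩
    rw [Reduction.pbr_skew]
    exact J.neg_mem (h i)
  · rw [Reduction.pbr_zero_right]
    exact J.zero_mem
  · intro b c _ _ hb hc
    rw [Reduction.pbr_add_right]
    exact J.add_mem hb hc
  · intro c b hbs hb
    rw [smul_eq_mul, Reduction.pbr_leibniz]
    exact J.add_mem (J.mul_mem_left _ (hle hbs)) (J.mul_mem_left _ hb)

/-- The constant term of a cocycle normalizes `J`. -/
theorem IsBFVModel.app_zero_mem_normalizer (hR : IsBFVModel 𝕜 J R) (hx : x ∈ comp M P 𝕜 0)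
    (h : dR 𝕜 R x = 0) : x 0 ∈ Reduction.normalizer 𝕜 J := by
  refine hR.mem_normalizer fun i => ?_
  set α : Expo M := Finsupp.single (es i) 1 with hα
  by_cases hi : M.deg i = 1
  swap
  · have h0 : R.1 α = 0 := by
      by_contra h
      have := (R.2 _ h).2
      rw [degree_single, genDeg_es] at this
      omega
    rw [h0, Reduction.pbr_zero_left]
    exact J.zero_mem
  have hg : ghost α = 1 := by rw [ghost_single, genGhost_es, hi]
  have hpos : IsPos α := isPos_single i
  have h1 : dR 𝕜 R (x - const (x 0)) (0 + α) = _ :=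
    dR_app_add (sub_const_mem_filt hx) (ghost_eq_zero.2 fun _ => rfl) hpos (allowed_single _) hg
  -- the part of `x` of positive order contributes the constant term of a coboundary
  have h2 := slice_mem_comp hpos (Submodule.sub_mem _ hx (const_comp 𝕜 (x 0)))
  rw [hg, show (0 : ℤ) - (1 : ℕ) = -1 from rfl] at h2
  have h3 := (hR.mem_iff _).2 ⟨_, h2, rfl⟩
  rw [← h1, map_sub, h, zero_sub, neg_app, dR_const_app, zero_add] at h3
  simpa using J.neg_mem h3

/-- Every element of the normalizer of `J` is the constant term of a cocycle. -/
theorem IsBFVModel.exists_cocycle [CharZero 𝕜] (hR : IsBFVModel 𝕜 J R) {a : P}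
    (ha : a ∈ Reduction.normalizer 𝕜 J) : ∃ x ∈ comp M P 𝕜 0, dR 𝕜 R x = 0 ∧ x 0 = a := by
  have hc : dR 𝕜 R (const a) ∈ comp M P 𝕜 1 := dR_mem_comp (const_comp 𝕜 a)
  have hcc : dR 𝕜 R (dR 𝕜 R (const a)) = 0 := dR_dR hR.master (const_comp 𝕜 a)
  -- in lowest order, the defect of the cocycle equation for `a` is given by the brackets of `a`
  -- with generators of `J`
  obtain ⟨y, hy, hyf, h1⟩ : ∃ y ∈ comp M P 𝕜 (1 - 1), y ∈ filt M P 𝕜 1 ∧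
      dR 𝕜 R (const a) - dR 𝕜 R y ∈ filt M P 𝕜 (1 + 1) := by
    refine BFV.exists_sub_dR_mem_filt hc (dR_const 𝕜 R a) fun α hα hαA hαp => ?_
    have h1 := slice_mem_comp hα hc
    rw [hαp] at h1
    refine hR.exists_sub_dR_mem_zero h1 ?_
    obtain ⟨i, -, rfl⟩ := hα.eq_single hαp
    rw [slice, zero_add, dR_const_app, Reduction.pbr_skew]
    exact J.neg_mem (ha _ (hR.apply_es_mem i))
  obtain ⟨w, hw, hwf, h2⟩ := hR.exists_dR_eq (j := 1) (p := 1 + 1) (by norm_num)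
    (Submodule.sub_mem _ hc (by simpa using dR_mem_comp (R := R) hy)) h1
    (by rw [map_sub, hcc, dR_dR hR.master hy, sub_zero])
  have h0 : ghost (0 : Expo M) = 0 := ghost_eq_zero.2 fun _ => rfl
  have hy0 : y 0 = 0 := mem_filt_one.1 hyf 0 h0
  have hw0 : w 0 = 0 := by
    by_contra h
    have := hwf 0 h
    omega
  refine ⟨const a - y - w,
    Submodule.sub_mem _ (Submodule.sub_mem _ (const_comp 𝕜 a) hy) hw, ?_, ?_⟩
  · rw [map_sub, map_sub, h2, sub_self]
  · rw [sub_app, sub_app, hy0, hw0, const, if_pos rfl, sub_zero, sub_zero]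

/-- A cocycle is a coboundary if its constant term belongs to `J`. -/
theorem IsBFVModel.exists_coboundary [CharZero 𝕜] (hR : IsBFVModel 𝕜 J R)
    (hx : x ∈ comp M P 𝕜 0) (h : dR 𝕜 R x = 0) (h0 : x 0 ∈ J) :
    ∃ y ∈ comp M P 𝕜 (-1), dR 𝕜 R y = x := by
  obtain ⟨y, hy, h1⟩ := hR.exists_sub_dR_mem_zero hx h0
  obtain ⟨w, hw, -, h2⟩ := hR.exists_dR_eq (j := 0) (p := 1) (by norm_num)
    (Submodule.sub_mem _ hx (by simpa using dR_mem_comp (R := R) hy)) h1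
    (by rw [map_sub, h, dR_dR hR.master hy, sub_zero])
  exact ⟨y + w, Submodule.add_mem _ hy hw, by rw [map_add, h2, add_sub_cancel]⟩

/-! ### The isomorphism -/

/-- The transport of the structure of a Poisson algebra along a linear equivalence. -/
noncomputable def PoissonStructure.transport {𝕜 H A : Type*} [Field 𝕜] [AddCommGroup H]
    [Module 𝕜 H] [CommRing A] [Algebra 𝕜 A] [PoissonAlgebra 𝕜 A] (e : H ≃ₗ[𝕜] A) :
    PoissonStructure 𝕜 H where
  one := e.symm 1
  mul := LinearMap.mk₂ 𝕜 (fun u v => e.symm (e u * e v)) (by simp [_root_.add_mul]) (by simp)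
    (by simp [_root_.mul_add]) (by simp)
  bracket := LinearMap.mk₂ 𝕜 (fun u v => e.symm (pbr 𝕜 (e u) (e v)))
    (by simp [Reduction.pbr_add_left]) (by simp [Reduction.pbr_smul_left])
    (by simp [Reduction.pbr_add_right]) (by simp [Reduction.pbr_smul_right])
  mul_assoc := by simp [_root_.mul_assoc]
  mul_comm := by simp [_root_.mul_comm]
  one_mul := by simp
  bracket_self := by simp [Reduction.pbr_self]
  jacobi a b c := by
    simp only [LinearMap.mk₂_apply, LinearEquiv.apply_symm_apply, ← map_add]
    rw [Reduction.pbr_jacobi]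
  leibniz a b c := by
    simp only [LinearMap.mk₂_apply, LinearEquiv.apply_symm_apply, ← map_add]
    rw [Reduction.pbr_leibniz]

/-- The map `x ↦ x 0 + J` from cocycles to `(P/J)^J`. -/
def IsBFVModel.constTerm (hR : IsBFVModel 𝕜 J R) :
    cocycles (dR 𝕜 R) (comp M P 𝕜) 0 →ₗ[𝕜] Reduction.invariants 𝕜 J where
  toFun x := ⟨Ideal.Quotient.mk J (x.1 0),
    ⟨x.1 0, hR.app_zero_mem_normalizer x.2.1 (LinearMap.mem_ker.1 x.2.2), rfl⟩⟩
  map_add' _ _ := rfl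
  map_smul' _ _ := rfl

theorem IsBFVModel.constTerm_apply (hR : IsBFVModel 𝕜 J R)
    (x : cocycles (dR 𝕜 R) (comp M P 𝕜) 0) :
    (hR.constTerm x : P ⧸ J) = Ideal.Quotient.mk J (x.1 0) := rfl

theorem IsBFVModel.ker_constTerm [CharZero 𝕜] (hR : IsBFVModel 𝕜 J R) :
    LinearMap.ker hR.constTerm =
      (coboundaries (dR 𝕜 R) (comp M P 𝕜) 0).submoduleOf (cocycles (dR 𝕜 R) (comp M P 𝕜) 0) := by
  ext x
  rw [LinearMap.mem_ker, ← Subtype.coe_inj, hR.constTerm_apply, Submodule.submoduleOf,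
    Submodule.mem_comap]
  change Ideal.Quotient.mk J (x.1 0) = 0 ↔ _
  rw [Ideal.Quotient.eq_zero_iff_mem]
  constructor
  · exact hR.exists_coboundary x.2.1 (LinearMap.mem_ker.1 x.2.2)
  · rintro ⟨y, hy, h⟩
    exact (hR.mem_iff _).2 ⟨y, hy, congrArg (fun u : Series M P => u 0) h⟩

theorem IsBFVModel.constTerm_surjective [CharZero 𝕜] (hR : IsBFVModel 𝕜 J R) :
    Function.Surjective hR.constTerm := by
  rintro ⟨_, a, ha, rfl⟩
  obtain ⟨x, hx, h, rfl⟩ := hR.exists_cocycle ha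
  exact ⟨⟨x, hx, h⟩, rfl⟩

/-- The isomorphism `H^0(X, d_R) → (P/J)^J`. -/
noncomputable def IsBFVModel.equiv [CharZero 𝕜] (hR : IsBFVModel 𝕜 J R) :
    H0 𝕜 R ≃ₗ[𝕜] Reduction.invariants 𝕜 J :=
  (Submodule.quotEquivOfEq _ _ hR.ker_constTerm.symm).trans
    (hR.constTerm.quotKerEquivOfSurjective hR.constTerm_surjective)

theorem IsBFVModel.equiv_mk [CharZero 𝕜] (hR : IsBFVModel 𝕜 J R)
    (x : cocycles (dR 𝕜 R) (comp M P 𝕜) 0) :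
    (hR.equiv (H0.mk 𝕜 R x) : P ⧸ J) = Ideal.Quotient.mk J (x.1 0) := rfl

theorem mul_mem_cocycles (x y : cocycles (dR 𝕜 R) (comp M P 𝕜) 0) :
    x.1 * y.1 ∈ cocycles (dR 𝕜 R) (comp M P 𝕜) 0 := by
  obtain ⟨x, hx, hx0⟩ := x
  obtain ⟨y, hy, hy0⟩ := y
  refine ⟨mul_mem_comp hx hy, ?_⟩
  refine LinearMap.mem_ker.2 ?_
  rw [dR_mul hx hy, LinearMap.mem_ker.1 hx0, LinearMap.mem_ker.1 hy0, zero_mul, mul_zero, add_zero]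

theorem bracket_mem_cocycles (x y : cocycles (dR 𝕜 R) (comp M P 𝕜) 0) :
    bracket 𝕜 x.1 y.1 ∈ cocycles (dR 𝕜 R) (comp M P 𝕜) 0 := by
  obtain ⟨x, hx, hx0⟩ := x
  obtain ⟨y, hy, hy0⟩ := y
  refine ⟨bracket_mem_comp hx hy, ?_⟩
  refine LinearMap.mem_ker.2 ?_
  rw [dR_bracket hx hy, LinearMap.mem_ker.1 hx0, LinearMap.mem_ker.1 hy0,
    bracket_zero_left, bracket_zero_right, add_zero]

theorem one_mem_cocycles : (1 : Series M P) ∈ cocycles (dR 𝕜 R) (comp M P 𝕜) 0 := by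
  refine ⟨const_comp 𝕜 1, LinearMap.mem_ker.2 (series_ext fun m => ?_)⟩
  change dR 𝕜 R (const 1) m = 0
  rw [dR_const_app, Reduction.pbr_skew, Reduction.pbr_one_left, neg_zero]

end BFV

theorem mainTheorem4 {𝕜 : Type*} [Field 𝕜] [CharZero 𝕜]
    {P : Type*} [CommRing P] [IsNoetherianRing P] [Algebra 𝕜 P] [PoissonAlgebra 𝕜 P]
    (J : Ideal P) [IsCoisotropic 𝕜 J]
    (M : GhostBasis) (R : BFV.comp M P 𝕜 1) (hR : BFV.IsBFVModel 𝕜 J R) :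
    -- the coboundaries are cocycles
    BFV.coboundaries (BFV.dR 𝕜 R) (BFV.comp M P 𝕜) 0 ≤
      BFV.cocycles (BFV.dR 𝕜 R) (BFV.comp M P 𝕜) 0 ∧
    -- `H^0(X, d_R)` is a Poisson algebra with the operations induced from `X`
    ∃ S : BFV.PoissonStructure 𝕜 (BFV.H0 𝕜 R),
      (∃ h1 : (1 : BFV.Series M P) ∈ BFV.cocycles (BFV.dR 𝕜 R) (BFV.comp M P 𝕜) 0,
        S.one = BFV.H0.mk 𝕜 R ⟨1, h1⟩) ∧
      (∀ x y : BFV.cocycles (BFV.dR 𝕜 R) (BFV.comp M P 𝕜) 0,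
        ∃ hxy : x.1 * y.1 ∈ BFV.cocycles (BFV.dR 𝕜 R) (BFV.comp M P 𝕜) 0,
          S.mul (BFV.H0.mk 𝕜 R x) (BFV.H0.mk 𝕜 R y) = BFV.H0.mk 𝕜 R ⟨x.1 * y.1, hxy⟩) ∧
      (∀ x y : BFV.cocycles (BFV.dR 𝕜 R) (BFV.comp M P 𝕜) 0,
        ∃ hxy : BFV.bracket 𝕜 x.1 y.1 ∈ BFV.cocycles (BFV.dR 𝕜 R) (BFV.comp M P 𝕜) 0,
          S.bracket (BFV.H0.mk 𝕜 R x) (BFV.H0.mk 𝕜 R y) =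
            BFV.H0.mk 𝕜 R ⟨BFV.bracket 𝕜 x.1 y.1, hxy⟩) ∧
      -- projecting to `P` and reducing modulo `J` is an isomorphism of Poisson algebras
      ∃ Φ : BFV.H0 𝕜 R ≃ₗ[𝕜] Reduction.invariants 𝕜 J,
        (∀ x : BFV.cocycles (BFV.dR 𝕜 R) (BFV.comp M P 𝕜) 0,
          (Φ (BFV.H0.mk 𝕜 R x) : P ⧸ J) = Ideal.Quotient.mk J (x.1 0)) ∧
        Φ S.one = 1 ∧
        (∀ u v : BFV.H0 𝕜 R, Φ (S.mul u v) = Φ u * Φ v) ∧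
        (∀ u v : BFV.H0 𝕜 R, Φ (S.bracket u v) = pbr 𝕜 (Φ u) (Φ v)) := by
  refine ⟨?_, BFV.PoissonStructure.transport hR.equiv, ⟨BFV.one_mem_cocycles, ?_⟩,
    fun x y => ⟨BFV.mul_mem_cocycles x y, ?_⟩, fun x y => ⟨BFV.bracket_mem_cocycles x y, ?_⟩,
    hR.equiv, hR.equiv_mk, ?_, fun u v => ?_, fun u v => ?_⟩
  · rintro _ ⟨y, hy, rfl⟩
    exact ⟨by simpa using BFV.dR_mem_comp (R := R) hy,
      LinearMap.mem_ker.2 (BFV.dR_dR hR.master hy)⟩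
  · refine hR.equiv.symm_apply_eq.2 (Subtype.ext ?_)
    rw [hR.equiv_mk]
    exact ((congrArg (Ideal.Quotient.mk J) BFV.one_app_zero).trans
      (map_one _)).symm
  · refine hR.equiv.symm_apply_eq.2 (Subtype.ext ?_)
    change (hR.equiv _ : P ⧸ J) * (hR.equiv _ : P ⧸ J) = _
    rw [hR.equiv_mk, hR.equiv_mk, hR.equiv_mk, ← map_mul]
    exact congrArg _ (BFV.mul_app_zero x.1 y.1).symm
  · refine hR.equiv.symm_apply_eq.2 (Subtype.ext ?_)
    rw [hR.equiv_mk]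
    exact (Reduction.invBracket_eq J
      (hR.app_zero_mem_normalizer x.2.1 (LinearMap.mem_ker.1 x.2.2))
      (hR.equiv_mk x).symm (hR.equiv_mk y).symm).trans
      (congrArg _ (BFV.bracket_app_zero x.2.1 y.1).symm)
  · exact hR.equiv.apply_symm_apply _
  · exact hR.equiv.apply_symm_apply _
  · exact hR.equiv.apply_symm_apply _
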